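/- Let $0<q<1$, $0<\mu<1$ and $\beta>-1$. Write $(a;q)_k=\prod_{i=0}^{k-1}(1-aq^i)$ for $k\in\mathbb N_0$, $(a;q)_\infty=\prod_{i\ge 0}(1-aq^i)$, $(a;q)_\nu=(a;q)_\infty/(aq^\nu;q)_\infty$ for real $\nu$, and $\Gamma_q(z)=\frac{(q;q)_\infty}{(q^z;q)_\infty}(1-q)^{1-z}$. Let $A_q=\{q^m:m\in\mathbb N_0\}$ and $A_q^*=A_q\cup\{0\}$. The Jackson integral is $\int_0^b f(t)\,d_qt=(1-q)\sum_{j\ge 0}bq^jf(bq^j)$, $\int_a^b=\int_0^b-\int_0^a$, and $D_qf(x)=\frac{f(x)-f(qx)}{(1-q)x}$, $D_{q^{-1}}f(x)=\frac{f(x)-f(x/q)}{(1-q^{-1})x}$ for $x\neq0$. For $\alpha>0$ put $$I_{q,0^+}^{\alpha}f(x)=\frac{x^{\alpha-1}}{\Gamma_q(\alpha)}\int_0^x(qt/x;q)_{\alpha-1}f(t)\,d_qt,\qquad I_{q,1^-}^{\alpha}f(x)=\frac{1}{\Gamma_q(\alpha)}\int_{qx}^1t^{\alpha-1}(qx/t;q)_{\alpha-1}f(t)\,d_qt,$$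 and let ${}^cD_{q,0^+}^{\mu}f=I_{q,0^+}^{1-\mu}D_qf$ and $D_{q,1^-}^{\mu}f=-\frac1q D_{q^{-1}}I_{q,1^-}^{1-\mu}f$. Consider the boundary value problem $$D_{q,1^-}^{\mu}\Big[(qx;q)_{\beta+\mu}\,{}^cD_{q,0^+}^{\mu}y\Big](x)=\lambda\,x^{-\mu}(qx;q)_\beta\,y(x),\qquad x\in A_q,$$ $$y(0)=\Big[I_{q,1^-}^{1-\mu}\,(q^{\beta+1}x;q)_\mu\,{}^cD_{q,0^+}^{\mu}y\Big]\Big(\frac1q\Big)=0.$$ A number $\lambda\in\mathbb C$ is an eigenvalue, with eigenfunction $y$, if $y:A_q^*\to\mathbb C$ is a solution of this problem that is not identically zero and is $q$-absolutely continuous, that is, $y(xq^n)\to y(0)$ as $n\to\infty$ for all $x\in A_q^*$ and there is a constant $K$ with $\sum_{j\ge0}|y(uq^j)-y(uq^{j+1})|\le K$ for all $u\in A_q^*$. For $n\in\mathbb N_0$ let $$\phi_n(x)=x^\mu p_n(x;q^\mu,q^\beta|q),\qquad p_n(x;q^\mu,q^\beta|q)=\sum_{k=0}^{n}\frac{(q^{-n};q)_k\,(q^{\mu+\beta+n+1};q)_k}{(q^{\mu+1};q)_k\,(q;q)_k}(qx)^k$$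 (little $q$-Jacobi polynomials), and $$\lambda_n=q^{-n\mu}\,\frac{\Gamma_q(\mu+\beta+n+1)\,\Gamma_q(\mu+n+1)}{\Gamma_q(\beta+n+1)\,\Gamma_q(n+1)}.$$ Then, for every $n\in\mathbb N_0$, $\lambda_n$ is an eigenvalue of the problem with eigenfunction $\phi_n$. Every eigenvalue is one of the $\lambda_n$, and every eigenfunction associated to $\lambda_n$ is a constant multiple of $\phi_n$ on $A_q^*$. -/

import Mathlib

noncomputable section

namespace QFrac

open Filter Topology

/-- The finite `q`-shifted factorial `(a; q)_k = ∏_{i<k} (1 - a q^i)`. -/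
def qPochFin (a q : ℝ) (k : ℕ) : ℝ := ∏ i ∈ Finset.range k, (1 - a * q ^ i)

/-- The infinite `q`-shifted factorial `(a; q)_∞`. -/
def qPochInf (a q : ℝ) : ℝ := ∏' i : ℕ, (1 - a * q ^ i)

/-- The `q`-shifted factorial of real order, `(a; q)_ν = (a; q)_∞ / (a q^ν; q)_∞`. -/
def qPoch (a q ν : ℝ) : ℝ := qPochInf a q / qPochInf (a * q ^ ν) q

/-- The `q`-gamma function `Γ_q(z) = (q; q)_∞ / (q^z; q)_∞ * (1 - q)^(1 - z)`. -/
def qGamma (q z : ℝ) : ℝ := qPochInf q q / qPochInf (q ^ z) q * (1 - q) ^ (1 - z)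

/-- The basic hypergeometric series `₂φ₁(a, b; c; q, z)`. -/
def basicHyp21 (a b c q z : ℝ) : ℝ :=
  ∑' k : ℕ, qPochFin a q k * qPochFin b q k / (qPochFin c q k * qPochFin q q k) * z ^ k

/-- The little `q`-Jacobi polynomial
`p_n(x; q^α, q^β | q) = ₂φ₁(q^{-n}, q^{α+β+n+1}; q^{α+1}; q, q x)`. -/
def littleQJacobi (q α β : ℝ) (n : ℕ) (x : ℝ) : ℝ :=
  basicHyp21 (q ^ (-(n : ℝ))) (q ^ (α + β + n + 1)) (q ^ (α + 1)) q (q * x)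

/-- The Jackson `q`-integral `∫_0^b f(t) d_q t = (1 - q) ∑_{j ≥ 0} b q^j f(b q^j)`. -/
def jacksonZero (q b : ℝ) (f : ℝ → ℂ) : ℂ :=
  ((1 - q : ℝ) : ℂ) * ∑' j : ℕ, ((b * q ^ j : ℝ) : ℂ) * f (b * q ^ j)

/-- The Jackson `q`-integral `∫_a^b f(t) d_q t`. -/
def jackson (q a b : ℝ) (f : ℝ → ℂ) : ℂ := jacksonZero q b f - jacksonZero q a f

/-- The Jackson `q`-difference operator `D_q f(x) = (f(x) - f(q x)) / ((1 - q) x)` at `x ≠ 0`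
(the only points at which it is used below); the base may be `q` or `q⁻¹`. -/
def qDiff (q : ℝ) (f : ℝ → ℂ) (x : ℝ) : ℂ := (f x - f (q * x)) / (((1 - q) * x : ℝ) : ℂ)

/-- The left-sided Riemann–Liouville `q`-fractional integral, based at `0`, at `x ≠ 0`:
`I_{q,0+}^α f(x) = x^{α-1} / Γ_q(α) ∫_0^x (q t / x; q)_{α-1} f(t) d_q t`. -/
def leftInt (q α : ℝ) (f : ℝ → ℂ) (x : ℝ) : ℂ :=
  ((x ^ (α - 1) / qGamma q α : ℝ) : ℂ) *
    jackson q 0 x (fun t => ((qPoch (q * t / x) q (α - 1) : ℝ) : ℂ) * f t)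

/-- The right-sided Riemann–Liouville `q`-fractional integral, based at `b`:
`I_{q,b-}^α f(x) = 1 / Γ_q(α) ∫_{q x}^b t^{α-1} (q x / t; q)_{α-1} f(t) d_q t`. -/
def rightInt (q b α : ℝ) (f : ℝ → ℂ) (x : ℝ) : ℂ :=
  ((1 / qGamma q α : ℝ) : ℂ) *
    jackson q (q * x) b
      (fun t => ((t ^ (α - 1) * qPoch (q * x / t) q (α - 1) : ℝ) : ℂ) * f t)

/-- The left-sided Caputo `q`-fractional derivative of order `α ∈ (0, 1)`,
`I_{q,0+}^{1-α} D_q f`. -/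
def leftCaputo (q α : ℝ) (f : ℝ → ℂ) (x : ℝ) : ℂ := leftInt q (1 - α) (qDiff q f) x

/-- The right-sided Riemann–Liouville `q`-fractional derivative of order `α ∈ (0, 1)`,
`(-1/q) D_{q⁻¹} I_{q,b-}^{1-α} f`. -/
def rightRL (q b α : ℝ) (f : ℝ → ℂ) (x : ℝ) : ℂ :=
  ((-1 / q : ℝ) : ℂ) * qDiff q⁻¹ (rightInt q b (1 - α) f) x

/-- The set `A_q = {q^m : m ∈ ℕ₀}`. -/
def qSet (q : ℝ) : Set ℝ := Set.range (fun m : ℕ => q ^ m)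

/-- The set `A_q^* = A_q ∪ {0}`. -/
def qSetStar (q : ℝ) : Set ℝ := qSet q ∪ {0}

/-- `q`-regularity at zero of a function on `A_q^*`. -/
def QRegular (q : ℝ) (f : ℝ → ℂ) : Prop :=
  ∀ x ∈ qSetStar q, Tendsto (fun n : ℕ => f (x * q ^ n)) atTop (𝓝 (f 0))

/-- `q`-absolutely continuous functions on `A_q^*`: `q`-regular at zero and
`∑_j |f(u q^j) - f(u q^{j+1})| ≤ K` for all `u ∈ A_q^*`, with `K` depending only on `f`. -/
def QAbsCont (q : ℝ) (f : ℝ → ℂ) : Prop :=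
  QRegular q f ∧ ∃ K : ℝ, ∀ u ∈ qSetStar q,
    Summable (fun j : ℕ => ‖f (u * q ^ j) - f (u * q ^ (j + 1))‖) ∧
      ∑' j : ℕ, ‖f (u * q ^ j) - f (u * q ^ (j + 1))‖ ≤ K

/-- The `q`-fractional Sturm–Liouville equation
`D_{q,1-}^μ ((q x; q)_{β+μ} ᶜD_{q,0+}^μ y)(x) = lam x^{-μ} (q x; q)_β y(x)` on `A_q`. -/
def SolvesEquation (q μ β : ℝ) (lam : ℂ) (y : ℝ → ℂ) : Prop :=
  ∀ x ∈ qSet q,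
    rightRL q 1 μ (fun t => ((qPoch (q * t) q (β + μ) : ℝ) : ℂ) * leftCaputo q μ y t) x =
      lam * ((x ^ (-μ) * qPoch (q * x) q β : ℝ) : ℂ) * y x

/-- The boundary conditions
`y(0) = [I_{q,1-}^{1-μ} (q^{β+1} x; q)_μ ᶜD_{q,0+}^μ y](1/q) = 0`. -/
def BoundaryConditions (q μ β : ℝ) (y : ℝ → ℂ) : Prop :=
  y 0 = 0 ∧
    rightInt q 1 (1 - μ)
      (fun t => ((qPoch (q ^ (β + 1) * t) q μ : ℝ) : ℂ) * leftCaputo q μ y t) (1 / q) = 0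

/-- `y` is an eigenfunction of the boundary value problem for the eigenvalue `lam`: a
`q`-absolutely continuous solution that is not identically zero on `A_q^*`. -/
def IsEigenfunction (q μ β : ℝ) (lam : ℂ) (y : ℝ → ℂ) : Prop :=
  QAbsCont q y ∧ (∃ x ∈ qSetStar q, y x ≠ 0) ∧
    SolvesEquation q μ β lam y ∧ BoundaryConditions q μ β y

/-- `φ_n(x) = x^μ p_n(x; q^μ, q^β | q)`. -/
def phi (q μ β : ℝ) (n : ℕ) (x : ℝ) : ℝ := x ^ μ * littleQJacobi q μ β n x

/-- `λ_n = q^{-nμ} Γ_q(μ+β+n+1) Γ_q(μ+n+1) / (Γ_q(β+n+1) Γ_q(n+1))`. -/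
def eigval (q μ β : ℝ) (n : ℕ) : ℝ :=
  q ^ (-(n : ℝ) * μ) * (qGamma q (μ + β + n + 1) * qGamma q (μ + n + 1)) /
    (qGamma q (β + n + 1) * qGamma q (n + 1))

end QFrac

end

/-
On the lattice `q ^ m` the fractional derivatives are convolutions with the kernel
`(q^{-μ}; q)_j / (q; q)_j * q^j`, the coefficients of a `q`-binomial series. The equation therefore
reads `L y = λ ρ y` with `L = Vᵀ w V`, where `V` is one such convolution and `w`, `ρ` are positive
weights. That `φ_n` solves it is checked on the generating functions in `z` of the two sides: by the
`q`-binomial theorem and the `q`-Pfaff–Saalschütz sum they agree at the points `z = q ^ l`.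

Conversely, `L` is symmetric, so an eigenfunction for `λ ≠ λ_n` is orthogonal to `φ_n` with respect
to `ρ`. A bounded `y` orthogonal to all `φ_n` has vanishing moments `∑ c_m y(q ^ m) (q ^ i) ^ m`
with `c_m > 0`; the power series with coefficients `c_m y(q ^ m)` thus vanishes at the points
`q ^ i → 0`, so `y = 0`. As the `λ_n` are strictly increasing, `y - c φ_n` is of this kind for every
eigenfunction `y` for `λ_n` and a suitable `c`.
-/

noncomputable section

namespace QFrac

open Filter Finset Topology

variable {q a z : ℝ}

/-! ### `q`-shifted factorials -/

lemma qPochFin_zero (a q : ℝ) : qPochFin a q 0 = 1 := prod_range_zero _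

lemma qPochFin_succ (a q : ℝ) (k : ℕ) :
    qPochFin a q (k + 1) = qPochFin a q k * (1 - a * q ^ k) :=
  prod_range_succ _ k

lemma qPochFin_add (a q : ℝ) (k j : ℕ) :
    qPochFin a q (k + j) = qPochFin a q k * qPochFin (a * q ^ k) q j := by
  simp only [qPochFin, prod_range_add, pow_add, mul_assoc]

lemma qPochFin_succ' (a q : ℝ) (k : ℕ) :
    qPochFin a q (k + 1) = (1 - a) * qPochFin (a * q) q k := by
  rw [add_comm, qPochFin_add, qPochFin_succ, qPochFin_zero, pow_zero, pow_one, mul_one, one_mul]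

lemma qPochFin_eq_zero {i k : ℕ} (h : a * q ^ i = 1) (hik : i < k) : qPochFin a q k = 0 :=
  prod_eq_zero (mem_range.2 hik) (by rw [h, sub_self])

lemma qPochFin_ne_zero {k : ℕ} (h : ∀ i < k, a * q ^ i ≠ 1) : qPochFin a q k ≠ 0 :=
  prod_ne_zero_iff.2 fun i hi => sub_ne_zero.2 (h i (mem_range.1 hi)).symm

lemma mul_pow_lt_one (hq0 : 0 < q) (hq1 : q < 1) (ha : a < 1) (i : ℕ) : a * q ^ i < 1 := by
  have hle : q ^ i ≤ 1 := pow_le_one₀ hq0.le hq1.le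
  have hpos : 0 < q ^ i := pow_pos hq0 i
  nlinarith

lemma abs_mul_pow_lt_one (hq : |q| < 1) (ha : |a| < 1) (i : ℕ) : |a * q ^ i| < 1 := by
  rw [abs_mul, abs_pow]
  exact mul_lt_one_of_nonneg_of_lt_one_left (abs_nonneg a) ha (pow_le_one₀ (abs_nonneg q) hq.le)

lemma mul_pow_ne_one (hq : |q| < 1) (ha : |a| < 1) (i : ℕ) : a * q ^ i ≠ 1 :=
  (lt_of_abs_lt (abs_mul_pow_lt_one hq ha i)).ne

lemma qPochFin_pos (hq0 : 0 < q) (hq1 : q < 1) (ha : a < 1) (k : ℕ) : 0 < qPochFin a q k :=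
  prod_pos fun i _ => sub_pos.2 (mul_pow_lt_one hq0 hq1 ha i)

lemma qPochFin_self_ne_zero (hq : |q| < 1) (k : ℕ) : qPochFin q q k ≠ 0 :=
  qPochFin_ne_zero fun i _ => mul_pow_ne_one hq hq i

lemma summable_mul_pow (hq : |q| < 1) (a : ℝ) : Summable fun i : ℕ => a * q ^ i :=
  (summable_geometric_of_abs_lt_one hq).mul_left a

lemma tendsto_qPochFin (hq : |q| < 1) (a : ℝ) :
    Tendsto (qPochFin a q) atTop (𝓝 (qPochInf a q)) := by
  have h := Real.multipliable_one_add_of_summable (summable_mul_pow hq a).neg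
  simp only [← sub_eq_add_neg] at h
  exact h.hasProd.tendsto_prod_nat

lemma qPochInf_split (hq : |q| < 1) (a : ℝ) (k : ℕ) :
    qPochInf a q = qPochFin a q k * qPochInf (a * q ^ k) q := by
  refine tendsto_nhds_unique ((tendsto_add_atTop_iff_nat k).2 (tendsto_qPochFin hq a)) ?_
  refine ((tendsto_qPochFin hq (a * q ^ k)).const_mul (qPochFin a q k)).congr fun j => ?_
  rw [add_comm j k, qPochFin_add]

lemma qPochInf_eq_zero (hq : |q| < 1) {i : ℕ} (h : a * q ^ i = 1) : qPochInf a q = 0 := by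
  rw [qPochInf_split hq a (i + 1), qPochFin_eq_zero h i.lt_succ_self, zero_mul]

lemma qPochInf_ne_zero (hq : |q| < 1) (h : ∀ i : ℕ, a * q ^ i ≠ 1) : qPochInf a q ≠ 0 := by
  have h' := tprod_one_add_ne_zero_of_summable (f := fun i : ℕ => -(a * q ^ i))
    (fun i => by rw [← sub_eq_add_neg]; exact sub_ne_zero.2 (h i).symm)
    (summable_mul_pow hq a).neg.norm
  simpa only [qPochInf, sub_eq_add_neg] using h'

lemma qPochInf_pos (hq0 : 0 < q) (hq1 : q < 1) (ha : a < 1) : 0 < qPochInf a q := by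
  have hq : |q| < 1 := (abs_of_pos hq0).trans_lt hq1
  refine lt_of_le_of_ne (ge_of_tendsto' (tendsto_qPochFin hq a) fun k => ?_)
    (qPochInf_ne_zero hq fun i => (mul_pow_lt_one hq0 hq1 ha i).ne).symm
  exact (qPochFin_pos hq0 hq1 ha k).le

lemma qPoch_eq_zero {ν : ℝ} (hq : |q| < 1) {i : ℕ} (h : a * q ^ i = 1) : qPoch a q ν = 0 := by
  rw [qPoch, qPochInf_eq_zero hq h, zero_div]

/-! ### The `q`-binomial theorem -/

/-- The coefficient `(a; q)_j / (q; q)_j` of the `q`-binomial series `₁φ₀(a; q, z)`. -/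
def qBinCoeff (a q : ℝ) (j : ℕ) : ℝ := qPochFin a q j / qPochFin q q j

lemma qBinCoeff_zero (a q : ℝ) : qBinCoeff a q 0 = 1 := by
  rw [qBinCoeff, qPochFin_zero, qPochFin_zero, div_one]

lemma qBinCoeff_pos (hq0 : 0 < q) (hq1 : q < 1) (ha : a < 1) (j : ℕ) : 0 < qBinCoeff a q j :=
  div_pos (qPochFin_pos hq0 hq1 ha j) (qPochFin_pos hq0 hq1 hq1 j)

lemma qBinCoeff_succ_mul (hq : |q| < 1) (a : ℝ) (j : ℕ) :
    qBinCoeff a q (j + 1) * (1 - q ^ (j + 1)) = qBinCoeff a q j * (1 - a * q ^ j) := by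
  have hj := qPochFin_self_ne_zero hq j
  have hj' := qPochFin_self_ne_zero hq (j + 1)
  rw [qPochFin_succ, ← pow_succ'] at hj'
  have := right_ne_zero_of_mul hj'
  rw [qBinCoeff, qBinCoeff, qPochFin_succ, qPochFin_succ, ← pow_succ']
  field_simp

lemma qBinCoeff_mul_sub (hq : |q| < 1) (a : ℝ) (j : ℕ) :
    qBinCoeff (a * q) q (j + 1) - qBinCoeff (a * q) q j = qBinCoeff a q (j + 1) * q ^ (j + 1) := by
  have hj := qPochFin_self_ne_zero hq j
  have hj' := qPochFin_self_ne_zero hq (j + 1)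
  rw [qPochFin_succ, ← pow_succ'] at hj'
  have := right_ne_zero_of_mul hj'
  simp only [qBinCoeff]
  rw [qPochFin_succ (a * q), qPochFin_succ q, qPochFin_succ' a, ← pow_succ']
  field_simp
  ring

lemma sum_qBinCoeff_mul_pow (hq : |q| < 1) (a : ℝ) (j : ℕ) :
    ∑ i ∈ range (j + 1), qBinCoeff a q i * q ^ i = qBinCoeff (a * q) q j := by
  induction j with
  | zero => simp [qBinCoeff_zero]
  | succ j ih => rw [sum_range_succ, ih, ← qBinCoeff_mul_sub hq, add_sub_cancel]

lemma exists_abs_qBinCoeff_le (hq : |q| < 1) (a : ℝ) : ∃ M : ℝ, ∀ j, |qBinCoeff a q j| ≤ M := by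
  have hq_ne : qPochInf q q ≠ 0 := qPochInf_ne_zero hq (mul_pow_ne_one hq hq)
  obtain ⟨M, hM⟩ := ((tendsto_qPochFin hq a).div (tendsto_qPochFin hq q) hq_ne).abs.bddAbove_range
  exact ⟨M, fun j => hM ⟨j, rfl⟩⟩

lemma summable_norm_qBinCoeff_mul_pow (hq : |q| < 1) (a : ℝ) (hz : |z| < 1) :
    Summable fun j : ℕ => ‖qBinCoeff a q j * z ^ j‖ := by
  obtain ⟨M, hM⟩ := exists_abs_qBinCoeff_le hq a
  refine Summable.of_nonneg_of_le (fun _ => norm_nonneg _) (fun j => ?_)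
    ((summable_geometric_of_lt_one (abs_nonneg z) hz).mul_left M)
  rw [norm_mul, norm_pow]
  exact mul_le_mul_of_nonneg_right (hM j) (pow_nonneg (abs_nonneg z) j)

lemma one_sub_mul_tsum_qBinCoeff_mul_pow (hq : |q| < 1) (a : ℝ) (hz : |z| < 1) :
    (1 - z) * ∑' j : ℕ, qBinCoeff a q j * z ^ j =
      (1 - a * z) * ∑' j : ℕ, qBinCoeff a q j * (z * q) ^ j := by
  have hzq : |z * q| < 1 := by simpa using abs_mul_pow_lt_one hq hz 1
  have sz := (summable_norm_qBinCoeff_mul_pow hq a hz).of_norm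
  have szq := (summable_norm_qBinCoeff_mul_pow hq a hzq).of_norm
  have h : ∑' j : ℕ, (qBinCoeff a q j * z ^ j - qBinCoeff a q j * (z * q) ^ j) =
      ∑' j : ℕ, (z * (qBinCoeff a q j * z ^ j) - a * z * (qBinCoeff a q j * (z * q) ^ j)) := by
    rw [(sz.sub szq).tsum_eq_zero_add]
    simp only [pow_zero, mul_one, sub_self, zero_add]
    refine tsum_congr fun j => ?_
    rw [mul_pow, mul_pow]
    linear_combination z ^ (j + 1) * qBinCoeff_succ_mul hq a j
  rw [sz.tsum_sub szq, (sz.mul_left z).tsum_sub (szq.mul_left (a * z)), tsum_mul_left,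
    tsum_mul_left] at h
  linarith

lemma qPochFin_mul_tsum_qBinCoeff_mul_pow (hq : |q| < 1) (a : ℝ) (hz : |z| < 1) (N : ℕ) :
    qPochFin z q N * ∑' j : ℕ, qBinCoeff a q j * z ^ j =
      qPochFin (a * z) q N * ∑' j : ℕ, qBinCoeff a q j * (z * q ^ N) ^ j := by
  induction N with
  | zero => simp [qPochFin_zero]
  | succ N ih =>
    have h := one_sub_mul_tsum_qBinCoeff_mul_pow hq a (abs_mul_pow_lt_one hq hz N)
    rw [mul_assoc z, ← pow_succ] at h
    rw [qPochFin_succ, qPochFin_succ]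
    linear_combination (1 - z * q ^ N) * ih + qPochFin (a * z) q N * h

lemma tendsto_tsum_qBinCoeff_mul_pow (hq : |q| < 1) (a : ℝ) (hz : |z| < 1) :
    Tendsto (fun N : ℕ => ∑' j : ℕ, qBinCoeff a q j * (z * q ^ N) ^ j) atTop (𝓝 1) := by
  have hlim : Tendsto (fun N : ℕ => z * q ^ N) atTop (𝓝 0) := by
    simpa using (tendsto_pow_atTop_nhds_zero_of_abs_lt_one hq).const_mul z
  have hle (N : ℕ) : |z * q ^ N| ≤ |z| := by
    rw [abs_mul, abs_pow]
    exact mul_le_of_le_one_right (abs_nonneg z) (pow_le_one₀ (abs_nonneg q) hq.le)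
  have h := tendsto_tsum_of_dominated_convergence (summable_norm_qBinCoeff_mul_pow hq a hz)
    (fun j => (hlim.pow j).const_mul (qBinCoeff a q j)) (Eventually.of_forall fun N j => by
      rw [norm_mul, norm_mul, norm_pow, norm_pow]
      exact mul_le_mul_of_nonneg_left (pow_le_pow_left₀ (abs_nonneg _) (hle N) j) (norm_nonneg _))
  rwa [tsum_eq_single 0 fun j hj => by simp [hj], pow_zero, mul_one, qBinCoeff_zero] at h

theorem hasSum_qBinCoeff_mul_pow (hq : |q| < 1) (a : ℝ) (hz : |z| < 1) :
    HasSum (fun j : ℕ => qBinCoeff a q j * z ^ j) (qPochInf (a * z) q / qPochInf z q) := by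
  suffices h : ∑' j : ℕ, qBinCoeff a q j * z ^ j = qPochInf (a * z) q / qPochInf z q from
    h ▸ (summable_norm_qBinCoeff_mul_pow hq a hz).of_norm.hasSum
  rw [eq_div_iff (qPochInf_ne_zero hq (mul_pow_ne_one hq hz)), mul_comm]
  refine tendsto_nhds_unique (((tendsto_qPochFin hq z).mul_const _).congr
    (qPochFin_mul_tsum_qBinCoeff_mul_pow hq a hz)) ?_
  simpa using (tendsto_qPochFin hq (a * z)).mul (tendsto_tsum_qBinCoeff_mul_pow hq a hz)

lemma hasSum_qBinCoeff_mul_sum (hq : |q| < 1) (a : ℝ) {s : ℝ} (hs : |s| < 1) (e : ℕ → ℝ) (n : ℕ) :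
    HasSum (fun m : ℕ => qBinCoeff a q m * s ^ m * ∑ i ∈ range n, e i * (q ^ m) ^ i)
      (∑ i ∈ range n, e i * (qPochInf (a * s * q ^ i) q / qPochInf (s * q ^ i) q)) := by
  have h := hasSum_sum fun i (_ : i ∈ range n) =>
    (hasSum_qBinCoeff_mul_pow hq a (abs_mul_pow_lt_one hq hs i)).mul_left (e i)
  simp only [← mul_assoc a s] at h
  refine h.congr_fun fun m => ?_
  rw [mul_sum]
  refine sum_congr rfl fun i _ => ?_
  rw [mul_pow, ← pow_mul, ← pow_mul, mul_comm i m]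
  ring

/-! ### The `q`-Pfaff–Saalschütz sum -/

section Saalschutz

variable {A b c d X : ℝ}

/-- The summand of the balanced series `₃φ₂(X⁻¹, A X, b; c, d; q, q)`, which terminates when
`X = q ^ n`. -/
def saalschutzTerm (q A b c d X : ℝ) (i : ℕ) : ℝ :=
  qPochFin X⁻¹ q i * qPochFin (A * X) q i * qPochFin b q i /
    (qPochFin q q i * qPochFin c q i * qPochFin d q i) * q ^ i

/-- The closed form of the partial sums in `sum_saalschutzTerm_contiguous`. -/
def saalschutzPartialSum (q A b c d X : ℝ) (N : ℕ) : ℝ :=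
  (1 - A * q * X ^ 2) * qPochFin X⁻¹ q N * qPochFin (A * (X * q)) q N * qPochFin b q (N + 1) /
    (qPochFin q q N * qPochFin c q N * qPochFin d q N)

lemma saalschutzPartialSum_succ_sub (hq0 : q ≠ 0) (hX : X ≠ 0) (hc : c ≠ 0)
    (hcd : c * d = A * b * q) {N : ℕ} (hqN : qPochFin q q (N + 1) ≠ 0)
    (hcN : qPochFin c q (N + 1) ≠ 0) (hdN : qPochFin d q (N + 1) ≠ 0) :
    saalschutzPartialSum q A b c d X (N + 1) - saalschutzPartialSum q A b c d X N =
      (1 - c * X) * (1 - d * X) * saalschutzTerm q A b c d (X * q) (N + 1) -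
        (b - c * X) * (1 - A * q * X / c) * saalschutzTerm q A b c d X (N + 1) := by
  have hXq : X⁻¹ = (X * q)⁻¹ * q := by field_simp
  have e1 : qPochFin (X * q)⁻¹ q (N + 1) = (1 - (X * q)⁻¹) * qPochFin X⁻¹ q N := by
    rw [qPochFin_succ', ← hXq]
  have e2 : qPochFin (A * X) q (N + 1) = (1 - A * X) * qPochFin (A * (X * q)) q N := by
    rw [qPochFin_succ', mul_assoc]
  simp only [saalschutzPartialSum, saalschutzTerm]
  rw [qPochFin_succ] at hqN hcN hdN
  obtain ⟨_, _⟩ := mul_ne_zero_iff.1 hqN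
  obtain ⟨_, hcN'⟩ := mul_ne_zero_iff.1 hcN
  obtain ⟨_, hdN'⟩ := mul_ne_zero_iff.1 hdN
  clear hqN hcN hdN
  rw [e1, e2, qPochFin_succ X⁻¹, qPochFin_succ (A * (X * q)), qPochFin_succ b q (N + 1),
    qPochFin_succ q, qPochFin_succ c, qPochFin_succ d, pow_succ q N]
  generalize qPochFin X⁻¹ q N = P1
  generalize qPochFin (A * (X * q)) q N = P2
  generalize qPochFin b q (N + 1) = P3
  generalize qPochFin q q N = D1 at *
  generalize qPochFin c q N = D2 at *
  generalize qPochFin d q N = D3 at *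
  generalize q ^ N = Y at *
  have hd : d = A * q * b / c := by rw [mul_right_comm, ← hcd]; field_simp
  have : c - A * q * Y * b ≠ 0 := by
    rw [show c - A * q * Y * b = c * (1 - d * Y) by linear_combination Y * hcd]
    exact mul_ne_zero hc hdN'
  rw [mul_comm c] at hcN'
  clear hdN' hcd hXq e1 e2
  subst hd
  field_simp
  ring

lemma sum_saalschutzTerm_contiguous (hq0 : q ≠ 0) (hX : X ≠ 0) (hc : c ≠ 0)
    (hcd : c * d = A * b * q) {N : ℕ} (hqN : qPochFin q q N ≠ 0)
    (hcN : qPochFin c q N ≠ 0) (hdN : qPochFin d q N ≠ 0) :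
    (1 - c * X) * (1 - d * X) * ∑ i ∈ range (N + 1), saalschutzTerm q A b c d (X * q) i -
        (b - c * X) * (1 - A * q * X / c) * ∑ i ∈ range (N + 1), saalschutzTerm q A b c d X i =
      saalschutzPartialSum q A b c d X N := by
  induction N with
  | zero =>
    have hd : d = A * b * q / c := by rw [← hcd]; field_simp
    simp only [saalschutzTerm, saalschutzPartialSum, zero_add, range_one, sum_singleton,
      qPochFin_zero, qPochFin_succ]
    rw [hd]
    field_simp
    ring
  | succ N ih =>
    have hstep := saalschutzPartialSum_succ_sub hq0 hX hc hcd hqN hcN hdN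
    rw [qPochFin_succ] at hqN hcN hdN
    have ih := ih (left_ne_zero_of_mul hqN) (left_ne_zero_of_mul hcN) (left_ne_zero_of_mul hdN)
    rw [sum_range_succ, sum_range_succ _ (N + 1)]
    linear_combination ih - hstep

theorem sum_saalschutzTerm (hq0 : q ≠ 0) (hc : c ≠ 0) (hcd : c * d = A * b * q) {n : ℕ}
    (hqn : qPochFin q q n ≠ 0) (hcn : qPochFin c q n ≠ 0) (hdn : qPochFin d q n ≠ 0) :
    ∑ i ∈ range (n + 1), saalschutzTerm q A b c d (q ^ n) i =
      (∏ i ∈ range n, (b - c * q ^ i)) * qPochFin (A * q / c) q n /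
        (qPochFin c q n * qPochFin d q n) := by
  induction n with
  | zero => simp [saalschutzTerm, qPochFin_zero]
  | succ n ih =>
    have hX : q ^ n ≠ 0 := pow_ne_zero n hq0
    have h := sum_saalschutzTerm_contiguous hq0 hX hc hcd hqn hcn hdn
    have hz : qPochFin (q ^ n)⁻¹ q (n + 1) = 0 :=
      qPochFin_eq_zero (inv_mul_cancel₀ hX) n.lt_succ_self
    rw [qPochFin_succ] at hqn hcn hdn
    obtain ⟨hcn, hcn'⟩ := mul_ne_zero_iff.1 hcn
    obtain ⟨hdn, hdn'⟩ := mul_ne_zero_iff.1 hdn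
    rw [sum_range_succ (saalschutzTerm q A b c d (q ^ n)), ih (left_ne_zero_of_mul hqn) hcn hdn,
      saalschutzTerm, saalschutzPartialSum, hz, ← pow_succ] at h
    refine mul_left_cancel₀ (mul_ne_zero hcn' hdn') ?_
    rw [prod_range_succ, qPochFin_succ (A * q / c), qPochFin_succ c, qPochFin_succ d]
    simp only [mul_zero, zero_mul, zero_div, add_zero] at h
    rw [sub_eq_zero.1 h]
    rw [mul_comm d] at hdn'
    field_simp

end Saalschutz

/-! ### Little `q`-Jacobi polynomials -/

section JacobiPoly

variable {A B c s : ℝ} {n : ℕ}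

/-- The coefficient of `x ^ i` in `jacobiPoly q A c n x`. -/
def jacobiCoeff (q A c : ℝ) (n i : ℕ) : ℝ :=
  qPochFin (q ^ n)⁻¹ q i * qPochFin (A * q ^ n) q i / (qPochFin c q i * qPochFin q q i) * q ^ i

/-- The polynomial `₂φ₁(q⁻ⁿ, A qⁿ; c; q, q x)`. The little `q`-Jacobi polynomial
`p_n(x; q^α, q^β | q)` is the case `A = q^(α+β+1)`, `c = q^(α+1)`; leaving `A` and `c` free also
covers the images of `φ_n` under fractional differentiation. -/
def jacobiPoly (q A c : ℝ) (n : ℕ) (x : ℝ) : ℝ :=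
  ∑ i ∈ range (n + 1), jacobiCoeff q A c n i * x ^ i

lemma jacobiCoeff_zero (q A c : ℝ) (n : ℕ) : jacobiCoeff q A c n 0 = 1 := by
  simp [jacobiCoeff, qPochFin_zero]

lemma littleQJacobi_eq_jacobiPoly (hq0 : 0 < q) (μ β : ℝ) (n : ℕ) (x : ℝ) :
    littleQJacobi q μ β n x = jacobiPoly q (q ^ (μ + β + 1)) (q ^ (μ + 1)) n x := by
  have hinv : q ^ (-(n : ℝ)) = (q ^ n)⁻¹ := by rw [Real.rpow_neg hq0.le, Real.rpow_natCast]
  have hA : q ^ (μ + β + n + 1) = q ^ (μ + β + 1) * q ^ n := by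
    rw [add_right_comm, Real.rpow_add hq0, Real.rpow_natCast]
  rw [littleQJacobi, basicHyp21, hinv, hA, tsum_eq_sum (s := range (n + 1))]
  · refine sum_congr rfl fun i _ => ?_
    rw [jacobiCoeff, mul_pow, mul_assoc _ (q ^ i)]
  · intro i hi
    have hni : n < i := by simpa using hi
    rw [qPochFin_eq_zero (inv_mul_cancel₀ (pow_pos hq0 n).ne') hni, zero_mul, zero_div, zero_mul]

lemma qPochFin_inv_pow_ne_zero (hq0 : 0 < q) (hq1 : q < 1) {i n : ℕ} (hin : i ≤ n) :
    qPochFin (q ^ n)⁻¹ q i ≠ 0 := by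
  refine qPochFin_ne_zero fun j hj h => ?_
  rw [inv_mul_eq_one₀ (pow_pos hq0 n).ne'] at h
  exact (hj.trans_le hin).ne' (pow_right_injective₀ hq0 hq1.ne h)

lemma jacobiCoeff_self_ne_zero (hq0 : 0 < q) (hq1 : q < 1) (hA : A < 1) (hc : c < 1) (n : ℕ) :
    jacobiCoeff q A c n n ≠ 0 :=
  mul_ne_zero (div_ne_zero
    (mul_ne_zero (qPochFin_inv_pow_ne_zero hq0 hq1 le_rfl)
      (qPochFin_pos hq0 hq1 (mul_pow_lt_one hq0 hq1 hA n) n).ne')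
    (mul_pos (qPochFin_pos hq0 hq1 hc n) (qPochFin_pos hq0 hq1 hq1 n)).ne') (pow_pos hq0 n).ne'

lemma exists_abs_jacobiPoly_le (q A c : ℝ) (n : ℕ) :
    ∃ M : ℝ, ∀ x, |x| ≤ 1 → |jacobiPoly q A c n x| ≤ M := by
  refine ⟨∑ i ∈ range (n + 1), |jacobiCoeff q A c n i|, fun x hx => ?_⟩
  refine (abs_sum_le_sum_abs _ _).trans (sum_le_sum fun i _ => ?_)
  rw [abs_mul, abs_pow]
  exact mul_le_of_le_one_right (abs_nonneg _) (pow_le_one₀ (abs_nonneg x) hx)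

lemma qPochInf_div_qPochInf_mul_pow (hq : |q| < 1) (a : ℝ) (hs : |s| < 1) {i : ℕ}
    (hi : qPochFin a q i ≠ 0) :
    qPochInf (a * q ^ i) q / qPochInf (s * q ^ i) q =
      qPochInf a q / qPochInf s q * (qPochFin s q i / qPochFin a q i) := by
  have : qPochInf (s * q ^ i) q ≠ 0 :=
    qPochInf_ne_zero hq (mul_pow_ne_one hq (abs_mul_pow_lt_one hq hs i))
  have : qPochFin s q i ≠ 0 := qPochFin_ne_zero fun j _ => mul_pow_ne_one hq hs j
  rw [qPochInf_split hq a i, qPochInf_split hq s i]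
  field_simp

theorem hasSum_qBinCoeff_mul_jacobiPoly (hq0 : q ≠ 0) (hq : |q| < 1) (hs : |s| < 1) (hc : c ≠ 0)
    (hcB : c * B = A * q) (hcn : qPochFin c q n ≠ 0) (hBs : qPochFin (B * s) q n ≠ 0) :
    HasSum (fun m : ℕ => qBinCoeff B q m * s ^ m * jacobiPoly q A c n (q ^ m))
      (qPochInf (B * s * q ^ n) q / qPochInf s q *
        (qPochFin B q n / qPochFin c q n * ∏ i ∈ range n, (s - c * q ^ i))) := by
  have hBsi {i : ℕ} (hi : i ∈ range (n + 1)) : qPochFin (B * s) q i ≠ 0 := by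
    rw [← Nat.add_sub_of_le (Nat.le_of_lt_succ (mem_range.1 hi)), qPochFin_add] at hBs
    exact left_ne_zero_of_mul hBs
  have hterm : ∀ i ∈ range (n + 1), jacobiCoeff q A c n i *
      (qPochInf (B * s * q ^ i) q / qPochInf (s * q ^ i) q) =
        qPochInf (B * s) q / qPochInf s q * saalschutzTerm q A s c (B * s) (q ^ n) i := by
    intro i hi
    rw [qPochInf_div_qPochInf_mul_pow hq _ hs (hBsi hi), jacobiCoeff, saalschutzTerm]
    ring
  have hB : A * q / c = B := by rw [← hcB, mul_div_cancel_left₀ _ hc]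
  have h := hasSum_qBinCoeff_mul_sum hq B hs (jacobiCoeff q A c n) (n + 1)
  rw [sum_congr rfl hterm, ← mul_sum, sum_saalschutzTerm hq0 hc (by rw [← mul_assoc, hcB]; ring)
    (qPochFin_self_ne_zero hq n) hcn hBs, hB, qPochInf_split hq (B * s) n] at h
  convert h using 1
  · rfl
  · field_simp

end JacobiPoly

/-! ### Series in a normed space -/

section Series

lemma hasSum_sum_antidiagonal {M : Type*} [AddCommMonoid M] [TopologicalSpace M] [ContinuousAdd M]
    [RegularSpace M] {F : ℕ × ℕ → M} {x : M} (hF : HasSum F x) :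
    HasSum (fun m => ∑ p ∈ antidiagonal m, F p) x := by
  refine (HasAntidiagonal.sigmaAntidiagonalEquivProd.hasSum_iff.2 hF).sigma fun m => ?_
  rw [← sum_finset_coe]
  exact hasSum_fintype _

variable {E : Type*} [NormedAddCommGroup E] [NormedSpace ℝ E]

lemma sum_sum_range_smul_sub (v : ℕ → ℝ) (y : ℕ → E) (N : ℕ) :
    ∑ j ∈ range N, (∑ i ∈ range (j + 1), v i) • (y j - y (j + 1)) =
      ∑ j ∈ range N, v j • y j - (∑ i ∈ range N, v i) • y N := by
  induction N with
  | zero => simp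
  | succ N ih =>
    rw [sum_range_succ, ih, sum_range_succ (fun j => v j • y j), sum_range_succ v]
    module

variable [CompleteSpace E]

lemma eq_zero_of_hasSum_pow_smul {ι : Type*} {l : Filter ι} [l.NeBot] {x : ι → ℝ}
    (hx : Tendsto x l (𝓝 0)) (hx0 : ∀ i, x i ≠ 0) (hx1 : ∀ i, |x i| ≤ 1) {a : ℕ → E}
    (ha : Summable fun m => ‖a m‖) (h : ∀ i, HasSum (fun m => x i ^ m • a m) 0) (m : ℕ) :
    a m = 0 := by
  induction m using Nat.strong_induction_on with
  | _ m ih =>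
    have hshift (i : ι) : ∑' j, x i ^ j • a (j + m) = 0 := by
      have hi := (hasSum_nat_add_iff' m).2 (h i)
      rw [sum_eq_zero fun j hj => by rw [ih j (mem_range.1 hj), smul_zero], sub_zero] at hi
      have hi' := hi.const_smul (x i ^ m)⁻¹
      simp_rw [pow_add, mul_comm _ (x i ^ m), mul_smul] at hi'
      simp only [inv_smul_smul₀ (pow_ne_zero m (hx0 i)), smul_zero] at hi'
      exact hi'.tsum_eq
    have hlim : Tendsto (fun i => ∑' j, x i ^ j • a (j + m)) l
        (𝓝 (∑' j, (0 : ℝ) ^ j • a (j + m))) :=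
      tendsto_tsum_of_dominated_convergence ((summable_nat_add_iff m).2 ha)
        (fun j => (hx.pow j).smul_const _) (Eventually.of_forall fun i j => by
          rw [norm_smul, norm_pow]
          exact mul_le_of_le_one_left (norm_nonneg _) (pow_le_one₀ (norm_nonneg _) (hx1 i)))
    simp_rw [hshift] at hlim
    have h0 := tendsto_nhds_unique hlim tendsto_const_nhds
    rw [tsum_eq_single 0 fun j hj => by rw [zero_pow hj, zero_smul]] at h0
    simpa using h0

/-- Power series are determined by their values at the points `q ^ l`. -/
lemma sum_antidiagonal_mul_eq {q : ℝ} (hq0 : q ≠ 0) (hq : |q| < 1) {u v w : ℕ → ℝ} {U V W : ℕ → ℝ}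
    (hu : ∀ l, HasSum (fun m => u m * (q ^ l) ^ m) (U l))
    (hv : ∀ l, HasSum (fun m => v m * (q ^ l) ^ m) (V l))
    (hw : ∀ l, HasSum (fun m => w m * (q ^ l) ^ m) (W l)) (h : ∀ l, U l * V l = W l) (m : ℕ) :
    ∑ p ∈ antidiagonal m, u p.1 * v p.2 = w m := by
  have hnorm {u : ℕ → ℝ} {U : ℕ → ℝ} (hu : ∀ l, HasSum (fun m => u m * (q ^ l) ^ m) (U l)) :
      Summable fun m => ‖u m‖ := by
    simpa only [pow_zero, one_pow, mul_one] using (hu 0).summable.norm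
  have hconv (l : ℕ) :
      HasSum (fun m => (∑ p ∈ antidiagonal m, u p.1 * v p.2) * (q ^ l) ^ m) (U l * V l) := by
    rw [← (hu l).tsum_eq, ← (hv l).tsum_eq, tsum_mul_tsum_eq_tsum_sum_antidiagonal_of_summable_norm
      (hu l).summable.norm (hv l).summable.norm]
    refine (summable_norm_sum_mul_antidiagonal_of_summable_norm (hu l).summable.norm
      (hv l).summable.norm).of_norm.hasSum.congr_fun fun m => ?_
    rw [sum_mul]
    refine sum_congr rfl fun p hp => ?_
    rw [← mem_antidiagonal.1 hp, pow_add]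
    ring
  refine sub_eq_zero.1 (eq_zero_of_hasSum_pow_smul (l := atTop) (x := fun l : ℕ => q ^ l)
    (tendsto_pow_atTop_nhds_zero_of_abs_lt_one hq) (fun l => pow_ne_zero l hq0)
    (fun l => by rw [abs_pow]; exact pow_le_one₀ (abs_nonneg q) hq.le)
    ((summable_norm_sum_mul_antidiagonal_of_summable_norm (hnorm hu) (hnorm hv)).of_norm.sub
      (hnorm hw).of_norm).norm (fun l => ?_) m)
  convert (hconv l).sub (hw l) using 2 with m
  · rw [smul_eq_mul]
    ring
  · rw [h, sub_self]

lemma tsum_sum_range_smul_sub {v : ℕ → ℝ} {y : ℕ → E} (hv : Summable fun j => ‖v j‖)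
    (hy : Tendsto y atTop (𝓝 0)) (hy' : Summable fun j => ‖y j - y (j + 1)‖) :
    ∑' j, (∑ i ∈ range (j + 1), v i) • (y j - y (j + 1)) = ∑' j, v j • y j := by
  obtain ⟨M, hM⟩ := hv.of_norm.hasSum.tendsto_sum_nat.norm.bddAbove_range
  replace hM (N : ℕ) : ‖∑ i ∈ range N, v i‖ ≤ M := hM ⟨N, rfl⟩
  obtain ⟨C, hC⟩ := hy.norm.bddAbove_range
  have hleft : Summable fun j => (∑ i ∈ range (j + 1), v i) • (y j - y (j + 1)) :=
    .of_norm_bounded (hy'.mul_left M) fun j => by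
      rw [norm_smul]
      exact mul_le_mul_of_nonneg_right (hM _) (norm_nonneg _)
  have hright : Summable fun j => v j • y j :=
    .of_norm_bounded (hv.mul_right C) fun j => by
      rw [norm_smul]
      exact mul_le_mul_of_nonneg_left (hC ⟨j, rfl⟩) (norm_nonneg _)
  have hboundary := hright.hasSum.tendsto_sum_nat.sub
    (hv.of_norm.hasSum.tendsto_sum_nat.smul hy)
  rw [smul_zero, sub_zero] at hboundary
  exact tendsto_nhds_unique hleft.hasSum.tendsto_sum_nat
    (hboundary.congr fun N => (sum_sum_range_smul_sub v y N).symm)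

lemma hasSum_sum_antidiagonal_smul {K g : ℕ → ℝ} (hK : Summable fun j => ‖K j‖)
    (hg : Summable g) {f : ℕ → ℕ → E} (hf : ∀ k j, ‖f (k + j) k‖ ≤ g k) :
    HasSum (fun m => ∑ p ∈ antidiagonal m, K p.1 • f m p.2) (∑' k, ∑' j, K j • f (k + j) k) := by
  have hF : Summable fun p : ℕ × ℕ => K p.1 • f (p.2 + p.1) p.2 := by
    have hg0 : 0 ≤ g := fun k => (norm_nonneg _).trans (hf k 0)
    refine .of_norm_bounded (hK.mul_of_nonneg hg (fun j => norm_nonneg (K j)) hg0) fun p => ?_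
    rw [norm_smul]
    exact mul_le_mul_of_nonneg_left (hf _ _) (norm_nonneg _)
  have htsum : ∑' p : ℕ × ℕ, K p.1 • f (p.2 + p.1) p.2 = ∑' k, ∑' j, K j • f (k + j) k := by
    rw [← (Equiv.prodComm ℕ ℕ).tsum_eq]
    exact ((Equiv.prodComm ℕ ℕ).summable_iff.2 hF).tsum_prod
  refine (htsum ▸ hasSum_sum_antidiagonal hF.hasSum).congr_fun fun m => ?_
  refine sum_congr rfl fun p hp => ?_
  rw [add_comm p.2, mem_antidiagonal.1 hp]

end Series

/-! ### The `q`-gamma function and the numbers `λ_n` -/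

section Eigval

variable {μ β x : ℝ}

lemma qGamma_pos (hq0 : 0 < q) (hq1 : q < 1) (hx : 0 < x) : 0 < qGamma q x :=
  mul_pos (div_pos (qPochInf_pos hq0 hq1 hq1)
    (qPochInf_pos hq0 hq1 (Real.rpow_lt_one hq0.le hq1 hx))) (Real.rpow_pos_of_pos (by linarith) _)

lemma qGamma_one (hq : |q| < 1) : qGamma q 1 = 1 := by
  rw [qGamma, Real.rpow_one, sub_self, Real.rpow_zero, mul_one,
    div_self (qPochInf_ne_zero hq (mul_pow_ne_one hq hq))]

lemma qGamma_add_nat (hq0 : 0 < q) (hq1 : q < 1) (hx : 0 < x) (n : ℕ) :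
    qGamma q (x + n) = qPochFin (q ^ x) q n / (1 - q) ^ n * qGamma q x := by
  have hqx : q ^ x < 1 := Real.rpow_lt_one hq0.le hq1 hx
  have := (qPochFin_pos hq0 hq1 hqx n).ne'
  have h1q : 0 < 1 - q := by linarith
  rw [qGamma, qGamma, qPochInf_split ((abs_of_pos hq0).trans_lt hq1) (q ^ x) n, Real.rpow_add hq0,
    Real.rpow_natCast, ← sub_sub, Real.rpow_sub h1q, Real.rpow_natCast]
  field_simp

lemma qPoch_self (hq0 : 0 < q) (hq1 : q < 1) (ν : ℝ) :
    qPoch q q ν = qGamma q (ν + 1) * (1 - q) ^ ν := by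
  have h1q : 0 < 1 - q := by linarith
  have := (Real.rpow_pos_of_pos h1q ν).ne'
  rw [qPoch, qGamma, Real.rpow_add_one hq0.ne', mul_comm q, sub_add_cancel_right,
    Real.rpow_neg h1q.le]
  field_simp

lemma eigval_eq (hq0 : 0 < q) (hq1 : q < 1) (hμ : 0 < μ) (hβ : -1 < β) (n : ℕ) :
    eigval q μ β n = eigval q μ β 0 * ((q ^ (-μ)) ^ n *
      (qPochFin (q ^ (μ + β + 1)) q n * qPochFin (q ^ (μ + 1)) q n /
        (qPochFin q q n * qPochFin (q ^ (β + 1)) q n))) := by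
  have h1q : 0 < 1 - q := by linarith
  have hpow : q ^ (-(n : ℝ) * μ) = (q ^ (-μ)) ^ n := by
    rw [neg_mul_comm, mul_comm, Real.rpow_mul_natCast hq0.le]
  have hone : qGamma q (n + 1) = qPochFin q q n / (1 - q) ^ n := by
    rw [add_comm, qGamma_add_nat hq0 hq1 one_pos, qGamma_one ((abs_of_pos hq0).trans_lt hq1),
      Real.rpow_one, mul_one]
  have : qPochFin q q n ≠ 0 := (qPochFin_pos hq0 hq1 hq1 n).ne'
  have : qPochFin (q ^ (β + 1)) q n ≠ 0 :=
    (qPochFin_pos hq0 hq1 (Real.rpow_lt_one hq0.le hq1 (by linarith)) n).ne'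
  have : qGamma q (β + 1) ≠ 0 := (qGamma_pos hq0 hq1 (by linarith)).ne'
  simp only [eigval, add_right_comm _ (n : ℝ) 1]
  rw [qGamma_add_nat hq0 hq1 (by linarith), qGamma_add_nat hq0 hq1 (by linarith),
    qGamma_add_nat hq0 hq1 (by linarith), hone, hpow, Nat.cast_zero, neg_zero, zero_mul,
    Real.rpow_zero, add_zero, add_zero, add_zero, zero_add,
    qGamma_one ((abs_of_pos hq0).trans_lt hq1)]
  field_simp

lemma eigval_zero_mul_qPoch (hq0 : 0 < q) (hq1 : q < 1) (hβ : -1 < β) :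
    eigval q μ β 0 * qPoch q q β = (1 - q) ^ (-(2 * μ)) * (qPoch q q μ * qPoch q q (β + μ)) := by
  have h1q : 0 < 1 - q := by linarith
  have : qGamma q (β + 1) ≠ 0 := (qGamma_pos hq0 hq1 (by linarith)).ne'
  have := (Real.rpow_pos_of_pos h1q μ).ne'
  rw [qPoch_self hq0 hq1, qPoch_self hq0 hq1, qPoch_self hq0 hq1, eigval, Nat.cast_zero, neg_zero,
    zero_mul, Real.rpow_zero, add_zero, add_zero, add_zero, zero_add,
    qGamma_one ((abs_of_pos hq0).trans_lt hq1), Real.rpow_add h1q, two_mul, neg_add,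
    Real.rpow_add h1q, Real.rpow_neg h1q.le, add_comm β μ]
  field_simp

lemma eigval_pos (hq0 : 0 < q) (hq1 : q < 1) (hμ : 0 < μ) (hβ : -1 < β) (n : ℕ) :
    0 < eigval q μ β n := by
  have : (0 : ℝ) ≤ n := n.cast_nonneg
  exact div_pos (mul_pos (Real.rpow_pos_of_pos hq0 _)
    (mul_pos (qGamma_pos hq0 hq1 (by linarith)) (qGamma_pos hq0 hq1 (by linarith))))
    (mul_pos (qGamma_pos hq0 hq1 (by linarith)) (qGamma_pos hq0 hq1 (by linarith)))

lemma eigval_succ (hq0 : 0 < q) (hq1 : q < 1) (hμ : 0 < μ) (hβ : -1 < β) (n : ℕ) :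
    eigval q μ β (n + 1) = eigval q μ β n * (q ^ (-μ) *
      (((1 - q ^ (μ + β + 1) * q ^ n) * (1 - q ^ (μ + 1) * q ^ n)) /
        ((1 - q * q ^ n) * (1 - q ^ (β + 1) * q ^ n)))) := by
  simp only [eigval_eq hq0 hq1 hμ hβ (n + 1), eigval_eq hq0 hq1 hμ hβ n, qPochFin_succ, pow_succ,
    mul_div_mul_comm]
  ring

lemma eigval_strictMono (hq0 : 0 < q) (hq1 : q < 1) (hμ : 0 < μ) (hβ : -1 < β) :
    StrictMono (eigval q μ β) := by
  refine strictMono_nat_of_lt_succ fun n => ?_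
  rw [eigval_succ hq0 hq1 hμ hβ]
  refine lt_mul_of_one_lt_right (eigval_pos hq0 hq1 hμ hβ n) ?_
  have hpos {ν : ℝ} (hν : 0 < ν) : 0 < 1 - q ^ ν * q ^ n :=
    sub_pos.2 (mul_pow_lt_one hq0 hq1 (Real.rpow_lt_one hq0.le hq1 hν) n)
  have hmono {ν : ℝ} : 1 - q ^ ν * q ^ n ≤ 1 - q ^ (μ + ν) * q ^ n :=
    sub_le_sub_left (mul_le_mul_of_nonneg_right
      (Real.rpow_le_rpow_of_exponent_ge hq0 hq1.le (by linarith)) (pow_nonneg hq0.le n)) 1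
  have hden : 0 < (1 - q ^ (1 : ℝ) * q ^ n) * (1 - q ^ (β + 1) * q ^ n) :=
    mul_pos (hpos one_pos) (hpos (by linarith))
  rw [Real.rpow_one] at hden
  refine one_lt_mul_of_lt_of_le (Real.one_lt_rpow_of_pos_of_lt_one_of_neg hq0 hq1 (by linarith))
    ((one_le_div hden).2 ?_)
  rw [mul_comm (1 - q * q ^ n), add_assoc μ]
  refine mul_le_mul hmono ?_ ?_ (hpos (by linarith)).le
  · simpa only [Real.rpow_one] using hmono (ν := 1)
  · simpa only [Real.rpow_one] using (hpos one_pos).le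

end Eigval

/-! ### The fractional operators on the lattice `q ^ m` -/

section Lattice

variable {α μ β ν : ℝ} {E : Type*} [NormedAddCommGroup E] [NormedSpace ℝ E]

/-- The convolution kernel `(q^{-μ}; q)_j / (q; q)_j * q^j` of the `q`-fractional derivatives of
order `μ` on the lattice `q ^ m`. -/
def fracKernel (q μ : ℝ) (j : ℕ) : ℝ := qBinCoeff (q ^ (-μ)) q j * q ^ j

/-- The left-sided `q`-fractional derivative of order `μ`, up to a power weight, as an operator on
sequences `y k`, which stand for the values at the lattice points `q ^ k`. -/
def latticeDeriv (q μ : ℝ) (y : ℕ → E) (k : ℕ) : E := ∑' j : ℕ, fracKernel q μ j • y (k + j)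

/-- The weight between the two fractional derivatives in the symmetric form of the equation. -/
def innerWeight (q μ β : ℝ) (k : ℕ) : ℝ := (q ^ k) ^ (1 - 2 * μ) * qPoch (q ^ (k + 1)) q (β + μ)

/-- The weight on the right-hand side of the symmetric form of the equation, with respect to which
the `φ_n` are orthogonal. -/
def outerWeight (q μ β : ℝ) (m : ℕ) : ℝ := (q ^ m) ^ (1 - μ) * qPoch (q ^ (m + 1)) q β

/-- The left-hand side of the equation, multiplied by `q ^ m` to make it symmetric, as an operator
on sequences. -/
def latticeOp (q μ β : ℝ) (y : ℕ → E) (m : ℕ) : E :=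
  (1 - q) ^ (-(2 * μ)) • ∑ p ∈ antidiagonal m,
    fracKernel q μ p.1 • innerWeight q μ β p.2 • latticeDeriv q μ y p.2

lemma summable_norm_fracKernel (hq : |q| < 1) (μ : ℝ) : Summable fun j => ‖fracKernel q μ j‖ :=
  summable_norm_qBinCoeff_mul_pow hq _ hq

lemma fracKernel_zero (q μ : ℝ) : fracKernel q μ 0 = 1 := by
  rw [fracKernel, qBinCoeff_zero, pow_zero, one_mul]

lemma rpow_neg_mul_self (hq0 : 0 < q) (μ : ℝ) : q ^ (-μ) * q = q ^ (1 - μ) := by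
  rw [← Real.rpow_add_one hq0.ne', neg_add_eq_sub]

lemma sum_fracKernel (hq0 : 0 < q) (hq1 : q < 1) (μ : ℝ) (j : ℕ) :
    ∑ i ∈ range (j + 1), fracKernel q μ i = qBinCoeff (q ^ (1 - μ)) q j := by
  rw [← rpow_neg_mul_self hq0, ← sum_qBinCoeff_mul_pow ((abs_of_pos hq0).trans_lt hq1)]
  rfl

lemma qPoch_pow_succ (hq0 : 0 < q) (hq1 : q < 1) (hν : -1 < ν) (j : ℕ) :
    qPoch (q ^ (j + 1)) q ν = qPoch q q ν * qBinCoeff (q ^ (ν + 1)) q j := by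
  have hq : |q| < 1 := (abs_of_pos hq0).trans_lt hq1
  have hc : q ^ (ν + 1) < 1 := Real.rpow_lt_one hq0.le hq1 (by linarith)
  have hshift : q ^ (j + 1) * q ^ ν = q ^ (ν + 1) * q ^ j := by
    rw [Real.rpow_add_one hq0.ne', pow_succ]; ring
  have := qPochFin_self_ne_zero hq j
  have := (qPochFin_pos hq0 hq1 hc j).ne'
  rw [qPoch, qPoch, qBinCoeff, hshift, mul_comm q (q ^ ν), ← Real.rpow_add_one hq0.ne',
    qPochInf_split hq q j, qPochInf_split hq (q ^ (ν + 1)) j, ← pow_succ']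
  field_simp

lemma qPoch_self_pos (hq0 : 0 < q) (hq1 : q < 1) (hν : -1 < ν) : 0 < qPoch q q ν := by
  rw [qPoch_self hq0 hq1]
  exact mul_pos (qGamma_pos hq0 hq1 (by linarith)) (Real.rpow_pos_of_pos (by linarith) ν)

lemma qPoch_pow_succ_div_qGamma (hq0 : 0 < q) (hq1 : q < 1) (hα : 0 < α) (j : ℕ) :
    qPoch (q ^ (j + 1)) q (α - 1) / qGamma q α =
      (1 - q) ^ (α - 1) * qBinCoeff (q ^ α) q j := by
  have := (qGamma_pos hq0 hq1 hα).ne'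
  rw [qPoch_pow_succ hq0 hq1 (by linarith), qPoch_self hq0 hq1, sub_add_cancel]
  field_simp

lemma leftInt_eq_tsum (hq0 : 0 < q) (hq1 : q < 1) (hα : 0 < α) {x : ℝ} (hx : 0 < x)
    (f : ℝ → ℂ) : leftInt q α f x =
      ((1 - q) * x) ^ α • ∑' j : ℕ, (qBinCoeff (q ^ α) q j * q ^ j) • f (x * q ^ j) := by
  have h1q : 0 < 1 - q := by linarith
  have hcoeff (j : ℕ) : x ^ (α - 1) / qGamma q α *
      ((1 - q) * (x * q ^ j * qPoch (q * (x * q ^ j) / x) q (α - 1))) =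
        ((1 - q) * x) ^ α * (qBinCoeff (q ^ α) q j * q ^ j) := by
    have harg : q * (x * q ^ j) / x = q ^ (j + 1) := by field_simp; ring
    rw [harg, Real.mul_rpow h1q.le hx.le]
    have h := qPoch_pow_succ_div_qGamma hq0 hq1 hα j
    rw [Real.rpow_sub_one h1q.ne', div_mul_eq_mul_div, eq_div_iff h1q.ne'] at h
    rw [Real.rpow_sub_one hx.ne']
    field_simp
    linear_combination h
  rw [leftInt, jackson, jacksonZero, jacksonZero]
  simp only [zero_mul, Complex.ofReal_zero, tsum_zero, mul_zero, sub_zero, Complex.real_smul,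
    ← tsum_mul_left]
  refine tsum_congr fun j => ?_
  simp only [← mul_assoc, ← Complex.ofReal_mul] at hcoeff ⊢
  rw [hcoeff]

lemma rightInt_one_div (hq0 : q ≠ 0) (b : ℝ) (g : ℝ → ℂ) : rightInt q b α g (b / q) = 0 := by
  rw [rightInt, mul_div_cancel₀ _ hq0, jackson, sub_self, mul_zero]

lemma rightInt_pow (hq0 : 0 < q) (hq1 : q < 1) (hα : 0 < α) (g : ℝ → ℂ) (m : ℕ) :
    rightInt q 1 α g (q ^ m) = (1 - q) ^ α • ∑ p ∈ antidiagonal m,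
      qBinCoeff (q ^ α) q p.1 • (q ^ p.2) ^ α • g (q ^ p.2) := by
  have hq : |q| < 1 := (abs_of_pos hq0).trans_lt hq1
  have h1q : 0 < 1 - q := by linarith
  set F : ℝ → ℂ := fun t => ((t ^ (α - 1) * qPoch (q * q ^ m / t) q (α - 1) : ℝ) : ℂ) * g t
  have hF (j : ℕ) : F (q ^ (m + 1 + j)) = 0 := by
    have harg : q * q ^ m / q ^ (m + 1 + j) * q ^ j = 1 := by
      rw [pow_add, pow_succ']
      field_simp
    simp only [F, qPoch_eq_zero hq harg, mul_zero, Complex.ofReal_zero, zero_mul]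
  have hlower : jacksonZero q (q * q ^ m) F = 0 := by
    simp only [jacksonZero, ← pow_succ', ← pow_add, hF, mul_zero, tsum_zero]
  have hupper : jacksonZero q 1 F =
      ((1 - q : ℝ) : ℂ) * ∑ p ∈ antidiagonal m, ((q ^ p.2 : ℝ) : ℂ) * F (q ^ p.2) := by
    rw [jacksonZero, tsum_eq_sum (s := range (m + 1)) fun j hj => ?_, ← Nat.sum_antidiagonal_swap,
      Nat.sum_antidiagonal_eq_sum_range_succ_mk]
    · simp only [one_mul, Prod.snd_swap, Nat.succ_eq_add_one]
    · obtain ⟨i, rfl⟩ := Nat.exists_eq_add_of_le (not_lt.1 (mem_range.not.1 hj))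
      rw [one_mul, hF, mul_zero]
  rw [rightInt, jackson, hlower, hupper, sub_zero, mul_sum, mul_sum, smul_sum]
  refine sum_congr rfl fun p hp => ?_
  have hcoeff : 1 / qGamma q α * ((1 - q) *
      (q ^ p.2 * ((q ^ p.2) ^ (α - 1) * qPoch (q * q ^ m / q ^ p.2) q (α - 1)))) =
        (1 - q) ^ α * (qBinCoeff (q ^ α) q p.1 * (q ^ p.2) ^ α) := by
    have harg : q * q ^ m / q ^ p.2 = q ^ (p.1 + 1) := by
      rw [← mem_antidiagonal.1 hp, pow_add, pow_succ]
      field_simp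
    have h := qPoch_pow_succ_div_qGamma hq0 hq1 hα p.1
    rw [Real.rpow_sub_one h1q.ne', div_mul_eq_mul_div, eq_div_iff h1q.ne'] at h
    rw [harg, Real.rpow_sub_one (pow_pos hq0 p.2).ne']
    field_simp
    linear_combination h
  simp only [F, Complex.real_smul, ← mul_assoc, ← Complex.ofReal_mul] at hcoeff ⊢
  rw [hcoeff]

lemma rightRL_eq (hq0 : q ≠ 0) (b : ℝ) (g : ℝ → ℂ) (x : ℝ) : rightRL q b μ g x =
    ((1 - q) * x)⁻¹ • (rightInt q b (1 - μ) g x - rightInt q b (1 - μ) g (q⁻¹ * x)) := by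
  have hcoeff : -1 / q * ((1 - q⁻¹) * x)⁻¹ = ((1 - q) * x)⁻¹ := by
    rw [neg_div, one_div, neg_mul, ← mul_inv, ← mul_assoc, mul_sub, mul_inv_cancel₀ hq0, mul_one,
      neg_inv, ← neg_mul, neg_sub]
  rw [rightRL, qDiff, Complex.real_smul, ← hcoeff, div_eq_mul_inv]
  push_cast
  ring

lemma rightRL_pow (hq0 : 0 < q) (hq1 : q < 1) (hμ : μ < 1) (g : ℝ → ℂ) (m : ℕ) :
    rightRL q 1 μ g (q ^ m) = ((1 - q) ^ (-μ) / q ^ m) • ∑ p ∈ antidiagonal m,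
      fracKernel q μ p.1 • (q ^ p.2) ^ (1 - μ) • g (q ^ p.2) := by
  have h1q : 0 < 1 - q := by linarith
  have hpow (m : ℕ) := rightInt_pow hq0 hq1 (sub_pos.2 hμ) g m
  have hcoeff : (1 - q) ^ (-μ) / q ^ m = ((1 - q) * q ^ m)⁻¹ * (1 - q) ^ (1 - μ) := by
    rw [sub_eq_neg_add 1 μ, Real.rpow_add_one h1q.ne']
    field_simp
  rw [rightRL_eq hq0.ne', hcoeff, mul_smul]
  congr 1
  cases m with
  | zero =>
    have hprev : rightInt q 1 (1 - μ) g (q⁻¹ * q ^ 0) = 0 := by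
      rw [pow_zero, mul_one, ← one_div, rightInt_one_div hq0.ne']
    rw [hprev, sub_zero, hpow]
    simp [fracKernel_zero, qBinCoeff_zero]
  | succ m =>
    have hprev : q⁻¹ * q ^ (m + 1) = q ^ m := by
      rw [pow_succ', inv_mul_cancel_left₀ hq0.ne']
    have hkernel (j : ℕ) : qBinCoeff (q ^ (1 - μ)) q (j + 1) - qBinCoeff (q ^ (1 - μ)) q j =
        fracKernel q μ (j + 1) := by
      rw [← sum_fracKernel hq0 hq1, ← sum_fracKernel hq0 hq1, sum_range_succ, add_sub_cancel_left]
    rw [hprev, hpow, hpow, ← smul_sub, Nat.sum_antidiagonal_succ, Nat.sum_antidiagonal_succ,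
      add_sub_assoc, ← sum_sub_distrib]
    simp only [← sub_smul, hkernel, fracKernel_zero, qBinCoeff_zero]

lemma leftCaputo_pow (hq0 : 0 < q) (hq1 : q < 1) (hμ : μ < 1) {y : ℝ → ℂ} (hy : QAbsCont q y)
    (hy0 : y 0 = 0) (m : ℕ) :
    leftCaputo q μ y (q ^ m) =
      ((1 - q) ^ (-μ) * (q ^ m) ^ (-μ)) • latticeDeriv q μ (fun k => y (q ^ k)) m := by
  have hm : 0 < q ^ m := pow_pos hq0 m
  have h1q : 0 < 1 - q := by linarith
  have hq : |q| < 1 := (abs_of_pos hq0).trans_lt hq1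
  have hmem : q ^ m ∈ qSetStar q := Or.inl ⟨m, rfl⟩
  have hlim := hy.1 _ hmem
  rw [hy0] at hlim
  obtain ⟨K, hK⟩ := hy.2
  have habel := tsum_sum_range_smul_sub (summable_norm_fracKernel hq μ) hlim (hK _ hmem).1
  simp only [sum_fracKernel hq0 hq1] at habel
  have hterm (j : ℕ) : (qBinCoeff (q ^ (1 - μ)) q j * q ^ j) • qDiff q y (q ^ m * q ^ j) =
      ((1 - q) * q ^ m)⁻¹ •
        qBinCoeff (q ^ (1 - μ)) q j • (y (q ^ m * q ^ j) - y (q ^ m * q ^ (j + 1))) := by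
    have hcoeff : qBinCoeff (q ^ (1 - μ)) q j * q ^ j * ((1 - q) * (q ^ m * q ^ j))⁻¹ =
        ((1 - q) * q ^ m)⁻¹ * qBinCoeff (q ^ (1 - μ)) q j := by
      field_simp
    rw [qDiff, mul_left_comm q, ← pow_succ', smul_smul, ← hcoeff, div_eq_inv_mul,
      ← Complex.ofReal_inv, ← Complex.real_smul, smul_smul]
  have hcoeff : ((1 - q) * q ^ m) ^ (1 - μ) * ((1 - q) * q ^ m)⁻¹ =
      (1 - q) ^ (-μ) * (q ^ m) ^ (-μ) := by
    rw [← Real.rpow_neg_one, ← Real.rpow_add (mul_pos h1q hm), sub_add_eq_add_sub,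
      add_neg_cancel, zero_sub, Real.mul_rpow h1q.le hm.le]
  rw [leftCaputo, leftInt_eq_tsum hq0 hq1 (sub_pos.2 hμ) hm, tsum_congr hterm, tsum_const_smul'',
    habel, smul_smul, hcoeff]
  simp only [latticeDeriv, pow_add]

lemma latticeOp_eq_smul_rightRL (hq0 : 0 < q) (hq1 : q < 1) (hμ : μ < 1) {y : ℝ → ℂ}
    (hy : QAbsCont q y) (hy0 : y 0 = 0) (m : ℕ) :
    latticeOp q μ β (fun k => y (q ^ k)) m = q ^ m • rightRL q 1 μ
      (fun t => ((qPoch (q * t) q (β + μ) : ℝ) : ℂ) * leftCaputo q μ y t) (q ^ m) := by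
  have h1q : 0 < 1 - q := by linarith
  have hweight (k : ℕ) : (q ^ k) ^ (1 - μ) *
      (qPoch (q * q ^ k) q (β + μ) * ((1 - q) ^ (-μ) * (q ^ k) ^ (-μ))) =
        (1 - q) ^ (-μ) * innerWeight q μ β k := by
    rw [innerWeight, two_mul, ← sub_sub, sub_eq_add_neg (1 - μ), Real.rpow_add (pow_pos hq0 k),
      ← pow_succ']
    ring
  have hsq : (1 - q) ^ (-(2 * μ)) = (1 - q) ^ (-μ) * (1 - q) ^ (-μ) := by
    rw [← Real.rpow_add h1q, two_mul, neg_add]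
  rw [rightRL_pow hq0 hq1 hμ, smul_smul, mul_div_cancel₀ _ (pow_pos hq0 m).ne', latticeOp, hsq,
    mul_smul, smul_sum]
  congr 1
  refine sum_congr rfl fun p _ => ?_
  rw [leftCaputo_pow hq0 hq1 hμ hy hy0, ← Complex.real_smul, smul_smul (qPoch _ _ _),
    smul_smul ((q ^ p.2) ^ (1 - μ)), hweight, mul_smul,
    smul_comm (fracKernel q μ p.1) ((1 - q) ^ (-μ))]

lemma solvesEquation_iff (hq0 : 0 < q) (hq1 : q < 1) (hμ : μ < 1) (lam : ℂ) {y : ℝ → ℂ}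
    (hy : QAbsCont q y) (hy0 : y 0 = 0) :
    SolvesEquation q μ β lam y ↔ ∀ m : ℕ,
      latticeOp q μ β (fun k => y (q ^ k)) m = lam * outerWeight q μ β m • y (q ^ m) := by
  rw [SolvesEquation, qSet, Set.forall_mem_range]
  refine forall_congr' fun m => ?_
  have hm : 0 < q ^ m := pow_pos hq0 m
  have hrhs : lam * outerWeight q μ β m • y (q ^ m) = q ^ m •
      (lam * (((q ^ m) ^ (-μ) * qPoch (q * q ^ m) q β : ℝ) : ℂ) * y (q ^ m)) := by
    rw [outerWeight, sub_eq_neg_add, Real.rpow_add_one hm.ne', ← pow_succ']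
    simp only [Complex.real_smul, Complex.ofReal_mul]
    ring
  rw [latticeOp_eq_smul_rightRL hq0 hq1 hμ hy hy0, hrhs, smul_right_inj hm.ne']

end Lattice

/-! ### The eigenvalue equation for `φ_n` -/

section EigenEquation

variable {μ β ν : ℝ}

lemma pow_rpow_eq_rpow_pow (hq0 : 0 < q) (μ : ℝ) (k : ℕ) : (q ^ k) ^ μ = (q ^ μ) ^ k := by
  rw [← Real.rpow_natCast_mul hq0.le, mul_comm, Real.rpow_mul_natCast hq0.le]

lemma phi_pow (hq0 : 0 < q) (μ β : ℝ) (n k : ℕ) : phi q μ β n (q ^ k) =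
    (q ^ μ) ^ k * jacobiPoly q (q ^ (μ + β + 1)) (q ^ (μ + 1)) n (q ^ k) := by
  rw [phi, littleQJacobi_eq_jacobiPoly hq0, pow_rpow_eq_rpow_pow hq0]

lemma phi_zero (hμ : μ ≠ 0) (q β : ℝ) (n : ℕ) : phi q μ β n 0 = 0 := by
  rw [phi, Real.zero_rpow hμ, zero_mul]

lemma latticeDeriv_phi (hq0 : 0 < q) (hq1 : q < 1) (hμ : -1 < μ) (β : ℝ) (n k : ℕ) :
    latticeDeriv q μ (fun k => phi q μ β n (q ^ k)) k =
      qPoch q q μ * (q ^ μ) ^ k * jacobiPoly q (q ^ (μ + β + 1)) q n (q ^ k) := by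
  have hq : |q| < 1 := (abs_of_pos hq0).trans_lt hq1
  have hs0 : 0 < q ^ (μ + 1) := Real.rpow_pos_of_pos hq0 _
  have hs1 : q ^ (μ + 1) < 1 := Real.rpow_lt_one hq0.le hq1 (by linarith)
  have hs : |q ^ (μ + 1)| < 1 := (abs_of_pos hs0).trans_lt hs1
  have has : q ^ (-μ) * q ^ (μ + 1) = q := by
    rw [← Real.rpow_add hq0, neg_add_cancel_left, Real.rpow_one]
  have hterm (j : ℕ) : fracKernel q μ j * phi q μ β n (q ^ (k + j)) =
      (q ^ μ) ^ k * (qBinCoeff (q ^ (-μ)) q j * (q ^ (μ + 1)) ^ j * ∑ i ∈ range (n + 1),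
        jacobiCoeff q (q ^ (μ + β + 1)) (q ^ (μ + 1)) n i * (q ^ k) ^ i * (q ^ j) ^ i) := by
    have hpow : (q ^ (μ + 1)) ^ j = (q ^ μ) ^ j * q ^ j := by
      rw [Real.rpow_add_one hq0.ne', mul_pow]
    rw [fracKernel, phi_pow hq0, jacobiPoly, hpow, pow_add, pow_add]
    simp only [mul_pow, mul_assoc]
    ring
  have hsum := (hasSum_qBinCoeff_mul_sum hq (q ^ (-μ)) hs (fun i =>
    jacobiCoeff q (q ^ (μ + β + 1)) (q ^ (μ + 1)) n i * (q ^ k) ^ i) (n + 1)).mul_left ((q ^ μ) ^ k)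
  simp only [latticeDeriv, smul_eq_mul, hterm]
  rw [hsum.tsum_eq, has, mul_comm (qPoch q q μ), mul_assoc, jacobiPoly]
  congr 1
  rw [mul_sum]
  refine sum_congr rfl fun i _ => ?_
  have := (qPochFin_pos hq0 hq1 hs1 i).ne'
  rw [qPochInf_div_qPochInf_mul_pow hq q hs (qPochFin_self_ne_zero hq i), qPoch, mul_comm q (q ^ μ),
    ← Real.rpow_add_one hq0.ne', jacobiCoeff, jacobiCoeff]
  field_simp

lemma innerWeight_mul_pow (hq0 : 0 < q) (hq1 : q < 1) (h : -1 < μ + β) (k : ℕ) :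
    innerWeight q μ β k * (q ^ μ) ^ k =
      qPoch q q (β + μ) * (qBinCoeff (q ^ (μ + β + 1)) q k * (q ^ (1 - μ)) ^ k) := by
  have hpow : (q ^ k) ^ (1 - 2 * μ) * (q ^ μ) ^ k = (q ^ (1 - μ)) ^ k := by
    rw [pow_rpow_eq_rpow_pow hq0, ← mul_pow, ← Real.rpow_add hq0]
    ring_nf
  rw [innerWeight, qPoch_pow_succ hq0 hq1 (by linarith), ← hpow, add_comm β μ]
  ring

lemma outerWeight_mul_pow (hq0 : 0 < q) (hq1 : q < 1) (hβ : -1 < β) (k : ℕ) :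
    outerWeight q μ β k * (q ^ μ) ^ k =
      qPoch q q β * (qBinCoeff (q ^ (β + 1)) q k * q ^ k) := by
  have hpow : (q ^ k) ^ (1 - μ) * (q ^ μ) ^ k = q ^ k := by
    rw [pow_rpow_eq_rpow_pow hq0, ← mul_pow, ← Real.rpow_add hq0, sub_add_cancel, Real.rpow_one]
  rw [outerWeight, qPoch_pow_succ hq0 hq1 hβ, mul_right_comm, hpow]
  ring

lemma prod_sub_mul_pow_eq (hq0 : 0 < q) (μ t : ℝ) (n : ℕ) :
    ∏ i ∈ range n, (q ^ (1 - μ) * t - q * q ^ i) =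
      (q ^ (-μ)) ^ n * ∏ i ∈ range n, (q * t - q ^ (μ + 1) * q ^ i) := by
  have hq : q ^ (-μ) * q ^ (μ + 1) = q := by
    rw [← Real.rpow_add hq0, neg_add_cancel_left, Real.rpow_one]
  rw [← card_range n, ← prod_const, card_range, ← prod_mul_distrib]
  refine prod_congr rfl fun i _ => ?_
  rw [mul_sub, ← mul_assoc, rpow_neg_mul_self hq0, ← mul_assoc, hq]

lemma abs_rpow_mul_pow_lt_one (hq0 : 0 < q) (hq1 : q < 1) (hν : 0 < ν) (l : ℕ) :
    |q ^ ν * q ^ l| < 1 := by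
  rw [abs_of_pos (by positivity)]
  exact mul_pow_lt_one hq0 hq1 (Real.rpow_lt_one hq0.le hq1 hν) l

lemma qPochFin_rpow_mul_pow_pos (hq0 : 0 < q) (hq1 : q < 1) (hν : 0 < ν) (l n : ℕ) :
    0 < qPochFin (q ^ ν * q ^ l) q n :=
  qPochFin_pos hq0 hq1 (mul_pow_lt_one hq0 hq1 (Real.rpow_lt_one hq0.le hq1 hν) l) n

lemma hasSum_fracKernel_mul_pow (hq0 : 0 < q) (hq1 : q < 1) (μ : ℝ) (l : ℕ) :
    HasSum (fun j => fracKernel q μ j * (q ^ l) ^ j)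
      (qPochInf (q ^ (1 - μ) * q ^ l) q / qPochInf (q * q ^ l) q) := by
  have hq : |q| < 1 := (abs_of_pos hq0).trans_lt hq1
  have h := hasSum_qBinCoeff_mul_pow hq (q ^ (-μ)) (abs_mul_pow_lt_one hq hq l)
  simpa only [fracKernel, mul_pow, mul_assoc, ← rpow_neg_mul_self hq0] using h

lemma hasSum_latticeDeriv_phi_mul_pow (hq0 : 0 < q) (hq1 : q < 1) (hμ : μ < 1) (hβ : -2 < β)
    (n l : ℕ) :
    HasSum (fun k => qBinCoeff (q ^ (μ + β + 1)) q k * (q ^ (1 - μ)) ^ k *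
        jacobiPoly q (q ^ (μ + β + 1)) q n (q ^ k) * (q ^ l) ^ k)
      (qPochInf (q ^ (β + 2) * q ^ l * q ^ n) q / qPochInf (q ^ (1 - μ) * q ^ l) q *
        (qPochFin (q ^ (μ + β + 1)) q n / qPochFin q q n *
          ∏ i ∈ range n, (q ^ (1 - μ) * q ^ l - q * q ^ i))) := by
  have hq : |q| < 1 := (abs_of_pos hq0).trans_lt hq1
  have hBs : q ^ (μ + β + 1) * (q ^ (1 - μ) * q ^ l) = q ^ (β + 2) * q ^ l := by
    rw [← mul_assoc, ← Real.rpow_add hq0]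
    ring_nf
  have h := hasSum_qBinCoeff_mul_jacobiPoly hq0.ne' hq
    (abs_rpow_mul_pow_lt_one hq0 hq1 (sub_pos.2 hμ) l) hq0.ne' (mul_comm q (q ^ (μ + β + 1)))
    (qPochFin_self_ne_zero hq n)
    (by rw [hBs]; exact (qPochFin_rpow_mul_pow_pos hq0 hq1 (by linarith) l n).ne')
  rw [hBs] at h
  refine h.congr_fun fun k => ?_
  rw [mul_pow]
  ring

lemma hasSum_phi_mul_pow (hq0 : 0 < q) (hq1 : q < 1) (hμ : -1 < μ) (hβ : -2 < β) (n l : ℕ) :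
    HasSum (fun k => qBinCoeff (q ^ (β + 1)) q k * q ^ k *
        jacobiPoly q (q ^ (μ + β + 1)) (q ^ (μ + 1)) n (q ^ k) * (q ^ l) ^ k)
      (qPochInf (q ^ (β + 2) * q ^ l * q ^ n) q / qPochInf (q * q ^ l) q *
        (qPochFin (q ^ (β + 1)) q n / qPochFin (q ^ (μ + 1)) q n *
          ∏ i ∈ range n, (q * q ^ l - q ^ (μ + 1) * q ^ i))) := by
  have hq : |q| < 1 := (abs_of_pos hq0).trans_lt hq1
  have hBs : q ^ (β + 1) * (q * q ^ l) = q ^ (β + 2) * q ^ l := by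
    rw [← mul_assoc, ← Real.rpow_add_one hq0.ne']
    ring_nf
  have hcB : q ^ (μ + 1) * q ^ (β + 1) = q ^ (μ + β + 1) * q := by
    rw [← Real.rpow_add hq0, ← Real.rpow_add_one hq0.ne']
    ring_nf
  have h := hasSum_qBinCoeff_mul_jacobiPoly hq0.ne' hq (abs_mul_pow_lt_one hq hq l)
    (Real.rpow_pos_of_pos hq0 (μ + 1)).ne' hcB
    (qPochFin_pos hq0 hq1 (Real.rpow_lt_one hq0.le hq1 (by linarith)) n).ne'
    (by rw [hBs]; exact (qPochFin_rpow_mul_pow_pos hq0 hq1 (by linarith) l n).ne')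
  rw [hBs] at h
  refine h.congr_fun fun k => ?_
  rw [mul_pow]
  ring

lemma sum_fracKernel_mul_jacobiPoly (hq0 : 0 < q) (hq1 : q < 1) (hμ0 : -1 < μ) (hμ1 : μ < 1)
    (hβ : -1 < β) (n m : ℕ) :
    ∑ p ∈ antidiagonal m, fracKernel q μ p.1 * (qBinCoeff (q ^ (μ + β + 1)) q p.2 *
        (q ^ (1 - μ)) ^ p.2 * jacobiPoly q (q ^ (μ + β + 1)) q n (q ^ p.2)) =
      (q ^ (-μ)) ^ n * (qPochFin (q ^ (μ + β + 1)) q n * qPochFin (q ^ (μ + 1)) q n /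
          (qPochFin q q n * qPochFin (q ^ (β + 1)) q n)) *
        (qBinCoeff (q ^ (β + 1)) q m * q ^ m *
          jacobiPoly q (q ^ (μ + β + 1)) (q ^ (μ + 1)) n (q ^ m)) := by
  have hq : |q| < 1 := (abs_of_pos hq0).trans_lt hq1
  have hright (l : ℕ) := (hasSum_phi_mul_pow hq0 hq1 hμ0 (by linarith : -2 < β) n l).mul_left
    ((q ^ (-μ)) ^ n * (qPochFin (q ^ (μ + β + 1)) q n * qPochFin (q ^ (μ + 1)) q n /
      (qPochFin q q n * qPochFin (q ^ (β + 1)) q n)))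
  simp only [← mul_assoc _ _ ((q ^ _) ^ _)] at hright
  refine sum_antidiagonal_mul_eq hq0.ne' hq (hasSum_fracKernel_mul_pow hq0 hq1 μ)
    (hasSum_latticeDeriv_phi_mul_pow hq0 hq1 hμ1 (by linarith) n) hright (fun l => ?_) m
  have : qPochInf (q ^ (1 - μ) * q ^ l) q ≠ 0 := qPochInf_ne_zero hq
    (mul_pow_ne_one hq (abs_rpow_mul_pow_lt_one hq0 hq1 (sub_pos.2 hμ1) l))
  have : qPochFin (q ^ (μ + 1)) q n ≠ 0 :=
    (qPochFin_pos hq0 hq1 (Real.rpow_lt_one hq0.le hq1 (by linarith)) n).ne'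
  have : qPochFin (q ^ (β + 1)) q n ≠ 0 :=
    (qPochFin_pos hq0 hq1 (Real.rpow_lt_one hq0.le hq1 (by linarith)) n).ne'
  rw [prod_sub_mul_pow_eq hq0]
  field_simp

theorem latticeOp_phi (hq0 : 0 < q) (hq1 : q < 1) (hμ0 : 0 < μ) (hμ1 : μ < 1) (hβ : -1 < β)
    (n m : ℕ) :
    latticeOp q μ β (fun k => phi q μ β n (q ^ k)) m =
      eigval q μ β n * (outerWeight q μ β m * phi q μ β n (q ^ m)) := by
  have hinner (k : ℕ) : innerWeight q μ β k * latticeDeriv q μ (fun k => phi q μ β n (q ^ k)) k =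
      qPoch q q μ * qPoch q q (β + μ) * (qBinCoeff (q ^ (μ + β + 1)) q k * (q ^ (1 - μ)) ^ k *
        jacobiPoly q (q ^ (μ + β + 1)) q n (q ^ k)) := by
    rw [latticeDeriv_phi hq0 hq1 (by linarith)]
    linear_combination qPoch q q μ * jacobiPoly q (q ^ (μ + β + 1)) q n (q ^ k) *
      innerWeight_mul_pow hq0 hq1 (by linarith : -1 < μ + β) k
  have houter : outerWeight q μ β m * phi q μ β n (q ^ m) = qPoch q q β *
      (qBinCoeff (q ^ (β + 1)) q m * q ^ m *
        jacobiPoly q (q ^ (μ + β + 1)) (q ^ (μ + 1)) n (q ^ m)) := by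
    rw [phi_pow hq0, ← mul_assoc, outerWeight_mul_pow hq0 hq1 hβ, mul_assoc]
  simp only [latticeOp, smul_eq_mul, hinner, mul_left_comm (fracKernel q μ _) (_ * qPoch q q _),
    ← mul_sum]
  rw [sum_fracKernel_mul_jacobiPoly hq0 hq1 (by linarith) hμ1 hβ, houter, ← mul_assoc,
    ← eigval_zero_mul_qPoch hq0 hq1 hβ, eigval_eq hq0 hq1 hμ0 hβ n]
  ring

lemma latticeOp_ofReal (q μ β : ℝ) (f : ℕ → ℝ) (m : ℕ) :
    latticeOp q μ β (fun k => (f k : ℂ)) m = ((latticeOp q μ β f m : ℝ) : ℂ) := by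
  simp only [latticeOp, latticeDeriv, Complex.real_smul, smul_eq_mul, Complex.ofReal_mul,
    Complex.ofReal_sum, Complex.ofReal_tsum]

end EigenEquation

/-! ### Decay of `φ_n` -/

section Decay

variable {μ β : ℝ}

lemma exists_abs_phi_pow_le (hq0 : 0 < q) (hq1 : q < 1) (μ β : ℝ) (n : ℕ) :
    ∃ C : ℝ, ∀ m : ℕ, |phi q μ β n (q ^ m)| ≤ C * (q ^ μ) ^ m := by
  obtain ⟨C, hC⟩ := exists_abs_jacobiPoly_le q (q ^ (μ + β + 1)) (q ^ (μ + 1)) n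
  refine ⟨C, fun m => ?_⟩
  rw [phi_pow hq0, abs_mul, mul_comm, abs_of_pos (by positivity : 0 < (q ^ μ) ^ m)]
  have hm : |q ^ m| ≤ 1 := by
    rw [abs_of_pos (pow_pos hq0 m)]
    exact pow_le_one₀ hq0.le hq1.le
  exact mul_le_mul_of_nonneg_right (hC _ hm) (by positivity)

lemma qAbsCont_of_norm_pow_le {y : ℝ → ℂ} {C r : ℝ} (hr0 : 0 ≤ r) (hr1 : r < 1) (hy0 : y 0 = 0)
    (hy : ∀ m : ℕ, ‖y (q ^ m)‖ ≤ C * r ^ m) : QAbsCont q y := by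
  have hC : 0 ≤ C := by simpa using (norm_nonneg _).trans (hy 0)
  have hshift (m j : ℕ) : ‖y (q ^ m * q ^ j)‖ ≤ C * r ^ j := by
    rw [← pow_add]
    exact (hy _).trans (mul_le_mul_of_nonneg_left
      (pow_le_pow_of_le_one hr0 hr1.le (Nat.le_add_left j m)) hC)
  have hgeom : Summable fun j => C * r ^ j := (summable_geometric_of_lt_one hr0 hr1).mul_left C
  have hbound : Summable fun j => C * r ^ j + C * r ^ (j + 1) :=
    hgeom.add ((summable_nat_add_iff 1).2 hgeom)
  refine ⟨?_, ∑' j, (C * r ^ j + C * r ^ (j + 1)), ?_⟩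
  · rintro x (⟨m, rfl⟩ | rfl)
    · rw [hy0]
      exact squeeze_zero_norm (hshift m) hgeom.tendsto_atTop_zero
    · simp only [zero_mul, tendsto_const_nhds]
  · rintro u (⟨m, rfl⟩ | rfl)
    · have hdiff (j : ℕ) := (norm_sub_le (y (q ^ m * q ^ j)) (y (q ^ m * q ^ (j + 1)))).trans
        (add_le_add (hshift m j) (hshift m (j + 1)))
      have hsum := Summable.of_nonneg_of_le (fun _ => norm_nonneg _) hdiff hbound
      exact ⟨hsum, hsum.tsum_le_tsum hdiff hbound⟩
    · simp only [zero_mul, sub_self, norm_zero, tsum_zero]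
      exact ⟨summable_zero, tsum_nonneg fun j => by positivity⟩

lemma qAbsCont_phi (hq0 : 0 < q) (hq1 : q < 1) (hμ : 0 < μ) (β : ℝ) (n : ℕ) :
    QAbsCont q fun x => (phi q μ β n x : ℂ) := by
  obtain ⟨C, hC⟩ := exists_abs_phi_pow_le hq0 hq1 μ β n
  refine qAbsCont_of_norm_pow_le (C := C) (Real.rpow_nonneg hq0.le μ)
    (Real.rpow_lt_one hq0.le hq1 hμ) ?_ fun m => ?_
  · rw [phi_zero hμ.ne', Complex.ofReal_zero]
  · rw [Complex.norm_real]
    exact hC m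

lemma exists_phi_ne_zero (hq0 : 0 < q) (hq1 : q < 1) (μ β : ℝ) (n : ℕ) :
    ∃ m : ℕ, phi q μ β n (q ^ m) ≠ 0 := by
  have hcont : Continuous (jacobiPoly q (q ^ (μ + β + 1)) (q ^ (μ + 1)) n) :=
    continuous_finsetSum _ fun i _ => continuous_const.mul (continuous_pow i)
  have hzero : jacobiPoly q (q ^ (μ + β + 1)) (q ^ (μ + 1)) n 0 = 1 := by
    simp [jacobiPoly, sum_range_succ', jacobiCoeff_zero]
  have hlim := (hcont.tendsto 0).comp (tendsto_pow_atTop_nhds_zero_of_lt_one hq0.le hq1)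
  obtain ⟨m, hm⟩ := (hlim.eventually_ne (hzero.trans_ne one_ne_zero)).exists
  exact ⟨m, by rw [phi_pow hq0]; exact mul_ne_zero (by positivity) hm⟩

end Decay

/-! ### Symmetry -/

section Symmetry

variable {μ β : ℝ} {E : Type*} [NormedAddCommGroup E] [NormedSpace ℝ E]

lemma norm_latticeDeriv_le (hq : |q| < 1) (μ : ℝ) {y : ℕ → E} {B : ℝ} {k : ℕ}
    (hy : ∀ j, ‖y (k + j)‖ ≤ B) :
    ‖latticeDeriv q μ y k‖ ≤ (∑' j, ‖fracKernel q μ j‖) * B := by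
  rw [← tsum_mul_right]
  refine tsum_of_norm_bounded ((summable_norm_fracKernel hq μ).mul_right B).hasSum fun j => ?_
  rw [norm_smul]
  exact mul_le_mul_of_nonneg_left (hy j) (norm_nonneg _)

lemma summable_norm_innerWeight_mul_pow (hq0 : 0 < q) (hq1 : q < 1) (hμ : μ < 1)
    (h : -1 < μ + β) : Summable fun k => ‖innerWeight q μ β k‖ * (q ^ μ) ^ k := by
  have hq : |q| < 1 := (abs_of_pos hq0).trans_lt hq1
  have hs0 : 0 < q ^ (1 - μ) := Real.rpow_pos_of_pos hq0 _
  have hs1 : |q ^ (1 - μ)| < 1 :=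
    (abs_of_pos hs0).trans_lt (Real.rpow_lt_one hq0.le hq1 (sub_pos.2 hμ))
  refine ((summable_norm_qBinCoeff_mul_pow hq (q ^ (μ + β + 1)) hs1).mul_left
    ‖qPoch q q (β + μ)‖).congr fun k => ?_
  rw [← norm_mul, ← innerWeight_mul_pow hq0 hq1 h, norm_mul,
    Real.norm_of_nonneg (by positivity : 0 ≤ (q ^ μ) ^ k)]

variable [CompleteSpace E] {φ g : ℕ → ℝ} {y : ℕ → E} {B : ℝ}

lemma tsum_smul_latticeOp (hq : |q| < 1) (hφ : ∀ m, |φ m| ≤ g m) (hg : Antitone g)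
    (hwg : Summable fun k => ‖innerWeight q μ β k‖ * g k) (hy : ∀ m, ‖y m‖ ≤ B) :
    ∑' m, φ m • latticeOp q μ β y m = (1 - q) ^ (-(2 * μ)) •
      ∑' k, (innerWeight q μ β k * latticeDeriv q μ φ k) • latticeDeriv q μ y k := by
  set S := ∑' j, ‖fracKernel q μ j‖
  have hφ' (k j : ℕ) : ‖φ (k + j)‖ ≤ g k := (hφ _).trans (hg (Nat.le_add_right k j))
  have hbound (k j : ℕ) : ‖φ (k + j) • innerWeight q μ β k • latticeDeriv q μ y k‖ ≤
      S * B * (‖innerWeight q μ β k‖ * g k) := by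
    have hVy : ‖latticeDeriv q μ y k‖ ≤ S * B := norm_latticeDeriv_le hq μ fun _ => hy _
    have hgk : 0 ≤ g k := (abs_nonneg _).trans (hφ k)
    calc ‖φ (k + j) • innerWeight q μ β k • latticeDeriv q μ y k‖
        = ‖φ (k + j)‖ * (‖innerWeight q μ β k‖ * ‖latticeDeriv q μ y k‖) := by
          rw [norm_smul, norm_smul]
      _ ≤ g k * (‖innerWeight q μ β k‖ * (S * B)) := by gcongr; exact hφ' k j
      _ = _ := by ring
  have hsum := hasSum_sum_antidiagonal_smul (summable_norm_fracKernel hq μ) (hwg.mul_left (S * B))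
    (f := fun m k => φ m • innerWeight q μ β k • latticeDeriv q μ y k) hbound
  have hkernel (k : ℕ) : Summable fun j => fracKernel q μ j * φ (k + j) :=
    .of_norm_bounded ((summable_norm_fracKernel hq μ).mul_right (g k)) fun j => by
      rw [norm_mul]
      exact mul_le_mul_of_nonneg_left (hφ' k j) (norm_nonneg _)
  have hterm (m : ℕ) : φ m • latticeOp q μ β y m = (1 - q) ^ (-(2 * μ)) • ∑ p ∈ antidiagonal m,
      fracKernel q μ p.1 • φ m • innerWeight q μ β p.2 • latticeDeriv q μ y p.2 := by
    rw [latticeOp, smul_comm, smul_sum]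
    simp only [smul_comm (φ m) (fracKernel q μ _)]
  rw [tsum_congr hterm, tsum_const_smul'', hsum.tsum_eq]
  congr 1
  refine tsum_congr fun k => ?_
  simp only [← mul_smul (fracKernel q μ _), (hkernel k).tsum_smul_const]
  rw [smul_smul, mul_comm]
  rfl

lemma tsum_latticeOp_smul (hq : |q| < 1) (hφ : ∀ m, |φ m| ≤ g m) (hg : Antitone g)
    (hwg : Summable fun k => ‖innerWeight q μ β k‖ * g k) (hy : ∀ m, ‖y m‖ ≤ B) :
    ∑' m, latticeOp q μ β φ m • y m = (1 - q) ^ (-(2 * μ)) •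
      ∑' k, (innerWeight q μ β k * latticeDeriv q μ φ k) • latticeDeriv q μ y k := by
  set S := ∑' j, ‖fracKernel q μ j‖
  have hbound (k j : ℕ) : ‖(innerWeight q μ β k * latticeDeriv q μ φ k) • y (k + j)‖ ≤
      S * B * (‖innerWeight q μ β k‖ * g k) := by
    have hVφ : ‖latticeDeriv q μ φ k‖ ≤ S * g k :=
      norm_latticeDeriv_le hq μ fun j => (hφ _).trans (hg (Nat.le_add_right k j))
    calc ‖(innerWeight q μ β k * latticeDeriv q μ φ k) • y (k + j)‖
        = ‖innerWeight q μ β k‖ * ‖latticeDeriv q μ φ k‖ * ‖y (k + j)‖ := by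
          rw [norm_smul, norm_mul]
      _ ≤ ‖innerWeight q μ β k‖ * (S * g k) * B :=
          mul_le_mul (mul_le_mul_of_nonneg_left hVφ (norm_nonneg _)) (hy _) (norm_nonneg _)
            (mul_nonneg (norm_nonneg _) ((norm_nonneg _).trans hVφ))
      _ = _ := by ring
  have hsum := hasSum_sum_antidiagonal_smul (summable_norm_fracKernel hq μ) (hwg.mul_left (S * B))
    (f := fun m k => (innerWeight q μ β k * latticeDeriv q μ φ k) • y m) hbound
  have hterm (m : ℕ) : latticeOp q μ β φ m • y m = (1 - q) ^ (-(2 * μ)) • ∑ p ∈ antidiagonal m,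
      fracKernel q μ p.1 • (innerWeight q μ β p.2 * latticeDeriv q μ φ p.2) • y m := by
    simp only [latticeOp, smul_assoc, sum_smul, mul_smul]
  rw [tsum_congr hterm, tsum_const_smul'', hsum.tsum_eq]
  congr 1
  refine tsum_congr fun k => ?_
  simp only [smul_comm (fracKernel q μ _), tsum_const_smul'']
  rfl

end Symmetry

/-! ### Completeness -/

section Completeness

variable {μ β : ℝ} {E : Type*} [NormedAddCommGroup E] [NormedSpace ℝ E] {y : ℕ → E} {B : ℝ}

lemma eq_zero_of_sum_range_succ_smul_eq_zero {c : ℕ → ℕ → ℝ} {x : ℕ → E} (hc : ∀ n, c n n ≠ 0)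
    (h : ∀ n, ∑ i ∈ range (n + 1), c n i • x i = 0) (n : ℕ) : x n = 0 := by
  induction n using Nat.strong_induction_on with
  | _ n ih =>
    have hn := h n
    rw [sum_range_succ, sum_eq_zero fun i hi => by rw [ih i (mem_range.1 hi), smul_zero],
      zero_add] at hn
    exact (smul_eq_zero.1 hn).resolve_left (hc n)

/-- The weighted inner product of a sequence `y m`, which stands for the values at the lattice
points `q ^ m`, with `φ_n`. -/
def pairing (q μ β : ℝ) (n : ℕ) (y : ℕ → E) : E :=
  ∑' m : ℕ, (outerWeight q μ β m * phi q μ β n (q ^ m)) • y m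

lemma outerWeight_mul_phi (hq0 : 0 < q) (hq1 : q < 1) (hβ : -1 < β) (n m : ℕ) :
    outerWeight q μ β m * phi q μ β n (q ^ m) = qPoch q q β * ∑ i ∈ range (n + 1),
      jacobiCoeff q (q ^ (μ + β + 1)) (q ^ (μ + 1)) n i *
        ((q ^ i) ^ m * (qBinCoeff (q ^ (β + 1)) q m * q ^ m)) := by
  rw [phi_pow hq0, ← mul_assoc, outerWeight_mul_pow hq0 hq1 hβ, jacobiPoly, mul_assoc, mul_sum]
  congr 1
  refine sum_congr rfl fun i _ => ?_
  rw [← pow_mul, ← pow_mul, mul_comm m]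
  ring

lemma summable_norm_qBinCoeff_mul_pow_smul (hq : |q| < 1) (a : ℝ) (hy : ∀ m, ‖y m‖ ≤ B) :
    Summable fun m => ‖(qBinCoeff a q m * q ^ m) • y m‖ := by
  refine .of_nonneg_of_le (fun _ => norm_nonneg _) (fun m => ?_)
    ((summable_norm_qBinCoeff_mul_pow hq a hq).mul_right B)
  rw [norm_smul]
  exact mul_le_mul_of_nonneg_left (hy m) (norm_nonneg _)

variable [CompleteSpace E]

lemma summable_pow_smul_qBinCoeff_mul_pow_smul (hq0 : 0 < q) (hq1 : q < 1) (a : ℝ)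
    (hy : ∀ m, ‖y m‖ ≤ B) (i : ℕ) :
    Summable fun m => (q ^ i) ^ m • (qBinCoeff a q m * q ^ m) • y m := by
  have hq : |q| < 1 := (abs_of_pos hq0).trans_lt hq1
  refine .of_norm_bounded (summable_norm_qBinCoeff_mul_pow_smul hq a hy) fun m => ?_
  rw [norm_smul, norm_pow, Real.norm_of_nonneg (pow_pos hq0 i).le]
  exact mul_le_of_le_one_left (norm_nonneg _)
    (pow_le_one₀ (pow_pos hq0 i).le (pow_le_one₀ hq0.le hq1.le))

lemma hasSum_pairing (hq0 : 0 < q) (hq1 : q < 1) (hβ : -1 < β) (hy : ∀ m, ‖y m‖ ≤ B) (n : ℕ) :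
    HasSum (fun m => (outerWeight q μ β m * phi q μ β n (q ^ m)) • y m)
      (qPoch q q β • ∑ i ∈ range (n + 1), jacobiCoeff q (q ^ (μ + β + 1)) (q ^ (μ + 1)) n i •
        ∑' m, (q ^ i) ^ m • (qBinCoeff (q ^ (β + 1)) q m * q ^ m) • y m) := by
  simp only [outerWeight_mul_phi hq0 hq1 hβ, mul_smul _ (∑ _ ∈ _, _), sum_smul]
  refine (hasSum_sum fun i _ => ?_).const_smul _
  simp only [mul_smul (jacobiCoeff _ _ _ _ _), mul_smul ((q ^ i) ^ _)]
  exact (summable_pow_smul_qBinCoeff_mul_pow_smul hq0 hq1 _ hy i).hasSum.const_smul _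

lemma eq_zero_of_pairing_eq_zero (hq0 : 0 < q) (hq1 : q < 1) (hμ : 0 < μ) (hβ : -1 < β)
    (hy : ∀ m, ‖y m‖ ≤ B) (h : ∀ n, pairing q μ β n y = 0) (m : ℕ) : y m = 0 := by
  have hq : |q| < 1 := (abs_of_pos hq0).trans_lt hq1
  have hA : q ^ (μ + β + 1) < 1 := Real.rpow_lt_one hq0.le hq1 (by linarith)
  have hc : q ^ (μ + 1) < 1 := Real.rpow_lt_one hq0.le hq1 (by linarith)
  have hmoment := eq_zero_of_sum_range_succ_smul_eq_zero
    (jacobiCoeff_self_ne_zero hq0 hq1 hA hc) fun n => (smul_eq_zero.1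
      ((hasSum_pairing hq0 hq1 hβ hy n).tsum_eq.symm.trans (h n))).resolve_left
        (qPoch_self_pos hq0 hq1 hβ).ne'
  have hzero := eq_zero_of_hasSum_pow_smul
    (tendsto_pow_atTop_nhds_zero_of_lt_one hq0.le hq1) (fun i => (pow_pos hq0 i).ne')
    (fun i => by rw [abs_of_pos (pow_pos hq0 i)]; exact pow_le_one₀ hq0.le hq1.le)
    (summable_norm_qBinCoeff_mul_pow_smul hq (q ^ (β + 1)) hy)
    fun i => hmoment i ▸ (summable_pow_smul_qBinCoeff_mul_pow_smul hq0 hq1 _ hy i).hasSum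
  exact (smul_eq_zero.1 (hzero m)).resolve_left (mul_pos
    (qBinCoeff_pos hq0 hq1 (Real.rpow_lt_one hq0.le hq1 (by linarith)) m) (pow_pos hq0 m)).ne'

lemma pairing_sub_mul (hq0 : 0 < q) (hq1 : q < 1) (hβ : -1 < β) {y w : ℕ → ℂ} {B B' : ℝ}
    (hy : ∀ m, ‖y m‖ ≤ B) (hw : ∀ m, ‖w m‖ ≤ B') (c : ℂ) (n : ℕ) :
    pairing q μ β n (fun m => y m - c * w m) = pairing q μ β n y - c * pairing q μ β n w := by
  have hpair {z : ℕ → ℂ} {B : ℝ} (hz : ∀ m, ‖z m‖ ≤ B) := hasSum_pairing (μ := μ) hq0 hq1 hβ hz n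
  simp only [pairing, smul_sub, ← mul_smul_comm]
  rw [(hpair hy).summable.tsum_sub ((hpair hw).summable.mul_left c), tsum_mul_left]

lemma eq_mul_of_pairing_eq_zero (hq0 : 0 < q) (hq1 : q < 1) (hμ : 0 < μ) (hβ : -1 < β)
    {y w : ℕ → ℂ} {B B' : ℝ} (hy : ∀ m, ‖y m‖ ≤ B) (hw : ∀ m, ‖w m‖ ≤ B') (hw0 : ∃ m, w m ≠ 0)
    {n : ℕ} (hyn : ∀ k ≠ n, pairing q μ β k y = 0) (hwn : ∀ k ≠ n, pairing q μ β k w = 0) :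
    ∃ c : ℂ, ∀ m, y m = c * w m := by
  have hn : pairing q μ β n w ≠ 0 := by
    intro hn
    obtain ⟨m, hm⟩ := hw0
    refine hm (eq_zero_of_pairing_eq_zero hq0 hq1 hμ hβ hw (fun k => ?_) m)
    exact (eq_or_ne k n).elim (fun hk => hk ▸ hn) (hwn k)
  set c := pairing q μ β n y / pairing q μ β n w with hc
  have hbound (m : ℕ) : ‖y m - c * w m‖ ≤ B + ‖c‖ * B' := by
    refine (norm_sub_le _ _).trans (add_le_add (hy m) ?_)
    rw [norm_mul]
    exact mul_le_mul_of_nonneg_left (hw m) (norm_nonneg _)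
  refine ⟨c, fun m => sub_eq_zero.1
    (eq_zero_of_pairing_eq_zero hq0 hq1 hμ hβ hbound (fun k => ?_) m)⟩
  rw [pairing_sub_mul hq0 hq1 hβ hy hw]
  rcases eq_or_ne k n with rfl | hk
  · rw [hc, div_mul_cancel₀ _ hn, sub_self]
  · rw [hyn k hk, hwn k hk, mul_zero, sub_zero]

end Completeness

/-! ### Eigenfunctions -/

section Eigenfunction

variable {μ β : ℝ}

lemma pairing_eq_zero_of_latticeOp_eq (hq0 : 0 < q) (hq1 : q < 1) (hμ0 : 0 < μ) (hμ1 : μ < 1)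
    (hβ : -1 < β) {lam : ℂ} {y : ℕ → ℂ} {B : ℝ} (hy : ∀ m, ‖y m‖ ≤ B)
    (heq : ∀ m, latticeOp q μ β y m = lam * outerWeight q μ β m • y m) {n : ℕ}
    (hn : lam ≠ (eigval q μ β n : ℂ)) : pairing q μ β n y = 0 := by
  have hq : |q| < 1 := (abs_of_pos hq0).trans_lt hq1
  have hr : q ^ μ ≤ 1 := Real.rpow_le_one hq0.le hq1.le hμ0.le
  obtain ⟨C, hC⟩ := exists_abs_phi_pow_le hq0 hq1 μ β n
  have hC0 : 0 ≤ C := by simpa using (abs_nonneg _).trans (hC 0)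
  have hanti : Antitone fun m => C * (q ^ μ) ^ m :=
    (pow_right_anti₀ (Real.rpow_nonneg hq0.le μ) hr).const_mul hC0
  have hsummable : Summable fun k => ‖innerWeight q μ β k‖ * (C * (q ^ μ) ^ k) :=
    ((summable_norm_innerWeight_mul_pow hq0 hq1 hμ1 (by linarith)).mul_left C).congr
      fun k => mul_left_comm _ _ _
  have hsymm := (tsum_smul_latticeOp hq hC hanti hsummable hy).trans
    (tsum_latticeOp_smul hq hC hanti hsummable hy).symm
  have hleft (m : ℕ) : phi q μ β n (q ^ m) • latticeOp q μ β y m =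
      lam * (outerWeight q μ β m * phi q μ β n (q ^ m)) • y m := by
    rw [heq, ← mul_smul_comm, smul_smul, mul_comm (phi _ _ _ _ _)]
  have hright (m : ℕ) : latticeOp q μ β (fun k => phi q μ β n (q ^ k)) m • y m =
      eigval q μ β n * (outerWeight q μ β m * phi q μ β n (q ^ m)) • y m := by
    rw [latticeOp_phi hq0 hq1 hμ0 hμ1 hβ, mul_smul, Complex.real_smul]
  rw [tsum_congr hleft, tsum_congr hright, tsum_mul_left, tsum_mul_left] at hsymm
  exact (mul_eq_mul_right_iff.1 hsymm).resolve_left hn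

lemma isEigenfunction_phi (hq0 : 0 < q) (hq1 : q < 1) (hμ0 : 0 < μ) (hμ1 : μ < 1) (hβ : -1 < β)
    (n : ℕ) : IsEigenfunction q μ β (eigval q μ β n : ℂ) fun x => (phi q μ β n x : ℂ) := by
  have hac := qAbsCont_phi hq0 hq1 hμ0 β n
  have hzero : (phi q μ β n 0 : ℂ) = 0 := by rw [phi_zero hμ0.ne', Complex.ofReal_zero]
  obtain ⟨m, hm⟩ := exists_phi_ne_zero hq0 hq1 μ β n
  refine ⟨hac, ⟨q ^ m, Or.inl ⟨m, rfl⟩, Complex.ofReal_ne_zero.2 hm⟩, ?_, hzero,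
    rightInt_one_div hq0.ne' 1 _⟩
  refine (solvesEquation_iff hq0 hq1 hμ1 _ hac hzero).2 fun m => ?_
  rw [latticeOp_ofReal, latticeOp_phi hq0 hq1 hμ0 hμ1 hβ, Complex.real_smul, Complex.ofReal_mul,
    Complex.ofReal_mul]

namespace IsEigenfunction

variable {lam : ℂ} {y : ℝ → ℂ}

lemma exists_norm_pow_le (hy : IsEigenfunction q μ β lam y) :
    ∃ B : ℝ, ∀ m : ℕ, ‖y (q ^ m)‖ ≤ B := by
  have hlim := hy.1.1 (q ^ 0) (Or.inl ⟨0, rfl⟩)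
  simp only [pow_zero, one_mul] at hlim
  obtain ⟨B, hB⟩ := hlim.norm.bddAbove_range
  exact ⟨B, fun m => hB ⟨m, rfl⟩⟩

lemma exists_pow_ne_zero (hy : IsEigenfunction q μ β lam y) : ∃ m : ℕ, y (q ^ m) ≠ 0 := by
  obtain ⟨_, ⟨m, rfl⟩ | rfl, hne⟩ := hy.2.1
  · exact ⟨m, hne⟩
  · exact absurd hy.2.2.2.1 hne

lemma pairing_eq_zero (hq0 : 0 < q) (hq1 : q < 1) (hμ0 : 0 < μ) (hμ1 : μ < 1) (hβ : -1 < β)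
    (hy : IsEigenfunction q μ β lam y) {n : ℕ} (hn : lam ≠ (eigval q μ β n : ℂ)) :
    pairing q μ β n (fun m => y (q ^ m)) = 0 := by
  obtain ⟨hac, -, heq, hzero, -⟩ := id hy
  obtain ⟨B, hB⟩ := hy.exists_norm_pow_le
  exact pairing_eq_zero_of_latticeOp_eq hq0 hq1 hμ0 hμ1 hβ hB
    ((solvesEquation_iff hq0 hq1 hμ1 _ hac hzero).1 heq) hn

lemma exists_eq_eigval (hq0 : 0 < q) (hq1 : q < 1) (hμ0 : 0 < μ) (hμ1 : μ < 1) (hβ : -1 < β)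
    (hy : IsEigenfunction q μ β lam y) : ∃ n : ℕ, lam = (eigval q μ β n : ℂ) := by
  by_contra! h
  obtain ⟨B, hB⟩ := hy.exists_norm_pow_le
  obtain ⟨m, hm⟩ := hy.exists_pow_ne_zero
  exact hm (eq_zero_of_pairing_eq_zero hq0 hq1 hμ0 hβ hB
    (fun n => hy.pairing_eq_zero hq0 hq1 hμ0 hμ1 hβ (h n)) m)

lemma eq_const_mul_phi (hq0 : 0 < q) (hq1 : q < 1) (hμ0 : 0 < μ) (hμ1 : μ < 1) (hβ : -1 < β)
    {n : ℕ} (hy : IsEigenfunction q μ β (eigval q μ β n : ℂ) y) :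
    ∃ c : ℂ, ∀ x ∈ qSetStar q, y x = c * (phi q μ β n x : ℂ) := by
  have hφ := isEigenfunction_phi hq0 hq1 hμ0 hμ1 hβ n
  obtain ⟨B, hB⟩ := hy.exists_norm_pow_le
  obtain ⟨B', hB'⟩ := hφ.exists_norm_pow_le
  have hne (k : ℕ) (hk : k ≠ n) : (eigval q μ β n : ℂ) ≠ (eigval q μ β k : ℂ) :=
    Complex.ofReal_injective.ne ((eigval_strictMono hq0 hq1 hμ0 hβ).injective.ne hk.symm)
  obtain ⟨c, hc⟩ := eq_mul_of_pairing_eq_zero hq0 hq1 hμ0 hβ hB hB' hφ.exists_pow_ne_zero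
    (fun k hk => hy.pairing_eq_zero hq0 hq1 hμ0 hμ1 hβ (hne k hk))
    (fun k hk => hφ.pairing_eq_zero hq0 hq1 hμ0 hμ1 hβ (hne k hk))
  refine ⟨c, ?_⟩
  rintro x (⟨m, rfl⟩ | rfl)
  · exact hc m
  · rw [hy.2.2.2.1, phi_zero hμ0.ne', Complex.ofReal_zero, mul_zero]

end IsEigenfunction

end Eigenfunction

end QFrac

end

theorem theorem5p5 (q : ℝ) (hq0 : 0 < q) (hq1 : q < 1) (μ : ℝ) (hμ0 : 0 < μ) (hμ1 : μ < 1)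
    (β : ℝ) (hβ : -1 < β) :
    (∀ n : ℕ, QFrac.IsEigenfunction q μ β ((QFrac.eigval q μ β n : ℝ) : ℂ)
      (fun x => ((QFrac.phi q μ β n x : ℝ) : ℂ))) ∧
    (∀ (lam : ℂ) (y : ℝ → ℂ), QFrac.IsEigenfunction q μ β lam y →
      ∃ n : ℕ, lam = ((QFrac.eigval q μ β n : ℝ) : ℂ)) ∧
    (∀ (n : ℕ) (y : ℝ → ℂ),
      QFrac.IsEigenfunction q μ β ((QFrac.eigval q μ β n : ℝ) : ℂ) y →
      ∃ c : ℂ, ∀ x ∈ QFrac.qSetStar q, y x = c * ((QFrac.phi q μ β n x : ℝ) : ℂ)) :=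
  ⟨QFrac.isEigenfunction_phi hq0 hq1 hμ0 hμ1 hβ,
    fun _ _ hy => hy.exists_eq_eigval hq0 hq1 hμ0 hμ1 hβ,
    fun _ _ hy => hy.eq_const_mul_phi hq0 hq1 hμ0 hμ1 hβ⟩
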